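/- Let $k$ be an algebraically closed field, let $R=k[x,y,z]$ with its standard grading, let $d\ge 1$ be an integer such that $\operatorname{char}(k)$ does not divide $d+1$, and let $f\in R$ be a nonzero homogeneous polynomial of degree $d+1$ that is reduced (i.e. $(f)$ is a radical ideal). Put $J_f=(f_x,f_y,f_z)\subset R$ and $$\operatorname{Syz}(J_f)=\{(g_1,g_2,g_3)\in R^3 : g_1f_x+g_2f_y+g_3f_z=0\},$$ graded by the degree of the coordinates $g_i$. Call $f$ a free divisor if the module $\{\delta\in\operatorname{Der}_k(R) : \delta(f)\in (f)\}$ of logarithmic derivations is a free $R$-module; call $f$ singular if $f,f_x,f_y,f_z$ have a common zero in $\mathbb P^2_k$, and smooth otherwise. For a homogeneous ideal $I$, $\deg(R/I)$ denotes $r!$ times the leading coefficient of the Hilbert polynomial of $R/I$, where $r$ is the degree of that polynomial (and the length of $R/I$ if this polynomial is zero). Let $\epsilon\in\operatorname{Syz}(J_f)$ be a minimal homogeneous generator (a member of a minimal set of homogeneous generators) of degree $e\geq 1$, and let $M_\epsilon=\operatorname{coker}(R(-e)\xrightarrow{\ \epsilon\ }\operatorname{Syz}(J_f))$, with projection $u:\operatorname{Syz}(J_f)\to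 M_\epsilon$. Then: (a) $M_\epsilon$ is a free $R$-module if and only if $f$ is a free divisor. In this case $\deg(R/J_f)=d^2+e(e-d)$. (b) If $f$ is not a free divisor, there are a proper homogeneous ideal $I_\epsilon\subset R$ of codimension two and an isomorphism $M_\epsilon\simeq I_\epsilon(e-d)$ of graded $R$-modules (homogeneous of degree zero). Moreover, for every such ideal $I_\epsilon$, $$\deg(R/I_\epsilon)=\begin{cases} d^2+e(e-d)-\deg(R/J_f) & \text{if } f \text{ is singular},\\ d^2+e(e-d) & \text{if } f \text{ is smooth}.\end{cases}$$ (c) Suppose $f$ is not a free divisor, and take any minimal set of homogeneous generators of $\operatorname{Syz}(J_f)$ that includes $\epsilon$. Then $\operatorname{Syz}(J_f)$ has a minimal graded free resolution based on these generators of the form $$0\to F_1\xrightarrow{\left[\begin{smallmatrix}\lambda\\ \psi\end{smallmatrix}\right]} R(-e)\oplus F_0\xrightarrow{(\epsilon,\phi)}\operatorname{Syz}(J_f)\to 0,$$ and for every such resolution and every ideal $I_\epsilon$ with a graded isomorphism $M_\epsilon\simeq I_\epsilon(e-d)$ as in (b), the sequence $$0\to F_1(d-e)\xrightarrow{\ \psi\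 }F_0(d-e)\xrightarrow{\ u\circ\phi\ }I_\epsilon\to 0$$ (where $M_\epsilon$ is identified with $I_\epsilon(e-d)$ by that isomorphism) is a minimal graded free resolution of $I_\epsilon$. In particular, $I_\epsilon$ is a perfect ideal of codimension $2$, i.e. the projective dimension of $R/I_\epsilon$ equals the grade of $I_\epsilon$. -/

import Mathlib

namespace PlaneCurve

/-- The polynomial ring `R = k[x, y, z]`, with its standard grading. -/
abbrev Ring3 (k : Type*) [Field k] := MvPolynomial (Fin 3) k

section Graded

/-! ### Graded modules

A `ℤ`-grading of an `R`-module `M` is recorded by the family `n ↦ M_n` of its homogeneous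
components. -/

/-- The component `R_n` of `R = k[x, y, z]`, for `n : ℤ`; it is zero for `n < 0`. -/
noncomputable def ringGrading (k : Type*) [Field k] (n : ℤ) : AddSubgroup (Ring3 k) :=
  if 0 ≤ n then (MvPolynomial.homogeneousSubmodule (Fin 3) k n.toNat).toAddSubgroup else ⊥

/-- The shifted graded module `M(s)`, with components `M(s)_n = M_{n + s}`. -/
def shift {M : Type*} [AddCommGroup M] (𝓜 : ℤ → AddSubgroup M) (s : ℤ) : ℤ → AddSubgroup M :=
  fun n => 𝓜 (n + s)

/-- The grading of a submodule `N` of a graded module: `N_n = N ∩ M_n`. -/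
def subGrading {A M : Type*} [CommRing A] [AddCommGroup M] [Module A M]
    (𝓜 : ℤ → AddSubgroup M) (N : Submodule A M) : ℤ → AddSubgroup N :=
  fun n => (𝓜 n).comap N.subtype.toAddMonoidHom

/-- The grading of a quotient `M ⧸ N` of a graded module: `(M ⧸ N)_n` is the image of `M_n`. -/
def quotGrading {A M : Type*} [CommRing A] [AddCommGroup M] [Module A M]
    (𝓜 : ℤ → AddSubgroup M) (N : Submodule A M) : ℤ → AddSubgroup (M ⧸ N) :=
  fun n => (𝓜 n).map N.mkQ.toAddMonoidHom

/-- The grading of the graded free module `⨁ i, R(-a i)`. -/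
noncomputable def freeGrading (k : Type*) [Field k] {ι : Type*} (a : ι → ℤ) (n : ℤ) :
    AddSubgroup (ι → Ring3 k) :=
  AddSubgroup.pi Set.univ fun i => ringGrading k (n - a i)

/-- A linear map is homogeneous of degree zero. -/
def IsGradedHom {A M N : Type*} [CommRing A] [AddCommGroup M] [AddCommGroup N] [Module A M]
    [Module A N] (𝓜 : ℤ → AddSubgroup M) (𝓝 : ℤ → AddSubgroup N) (φ : M →ₗ[A] N) : Prop :=
  ∀ n, ∀ x ∈ 𝓜 n, φ x ∈ 𝓝 n

/-- A linear isomorphism is an isomorphism of graded modules (homogeneous of degree zero). -/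
def IsGradedIso {A M N : Type*} [CommRing A] [AddCommGroup M] [AddCommGroup N] [Module A M]
    [Module A N] (𝓜 : ℤ → AddSubgroup M) (𝓝 : ℤ → AddSubgroup N) (θ : M ≃ₗ[A] N) : Prop :=
  ∀ n x, x ∈ 𝓜 n ↔ θ x ∈ 𝓝 n

/-- The irrelevant maximal ideal `(x, y, z)` of `R`. -/
noncomputable def irrelevant (k : Type*) [Field k] : Ideal (Ring3 k) :=
  Ideal.span (Set.range MvPolynomial.X)

/-- `0 → ⨁ j, R(-b j) --ψ--> ⨁ i, R(-a i) --φ--> M → 0` is a minimal graded free resolution of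
the graded module `(M, 𝓜)`. -/
structure IsMinimalGradedFreeResolution {k : Type*} [Field k] {M : Type*} [AddCommGroup M]
    [Module (Ring3 k) M] (𝓜 : ℤ → AddSubgroup M) {m n : ℕ} (a : Fin m → ℤ) (b : Fin n → ℤ)
    (ψ : (Fin n → Ring3 k) →ₗ[Ring3 k] (Fin m → Ring3 k))
    (φ : (Fin m → Ring3 k) →ₗ[Ring3 k] M) : Prop where
  graded_left : IsGradedHom (freeGrading k b) (freeGrading k a) ψ
  graded_right : IsGradedHom (freeGrading k a) 𝓜 φ
  injective : Function.Injective ψ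
  exact : Function.Exact ψ φ
  surjective : Function.Surjective φ
  minimal : LinearMap.range ψ ≤
    irrelevant k • (⊤ : Submodule (Ring3 k) (Fin m → Ring3 k))

end Graded

section Ideals

/-! ### Degree, grade and perfection of ideals -/

/-- The Hilbert function `n ↦ dim_k (R ⧸ I)_n` of `R ⧸ I`. -/
noncomputable def hilbertFunction {k : Type*} [Field k] (I : Ideal (Ring3 k)) (n : ℕ) : ℕ :=
  Module.finrank k (MvPolynomial.homogeneousSubmodule (Fin 3) k n ⧸
    (I.restrictScalars k).comap (MvPolynomial.homogeneousSubmodule (Fin 3) k n).subtype)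

/-- `P` is the Hilbert polynomial of `R ⧸ I`. -/
def IsHilbertPolynomial {k : Type*} [Field k] (I : Ideal (Ring3 k)) (P : Polynomial ℚ) : Prop :=
  ∀ᶠ n : ℕ in Filter.atTop, (hilbertFunction I n : ℚ) = P.eval (n : ℚ)

/-- `deg (R ⧸ I) = δ`, for a homogeneous ideal `I`: if the Hilbert polynomial `P` of `R ⧸ I` is
nonzero of degree `r`, then `δ` is `r!` times the leading coefficient of `P`; if `P = 0`, i.e. if
`R ⧸ I` has finite length, then `δ` is this length, i.e. `dim_k (R ⧸ I)`. -/
def HasDegree {k : Type*} [Field k] (I : Ideal (Ring3 k)) (δ : ℚ) : Prop :=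
  ∃ P : Polynomial ℚ, IsHilbertPolynomial I P ∧
    ((P ≠ 0 ∧ δ = (P.natDegree.factorial : ℚ) * P.leadingCoeff) ∨
      (P = 0 ∧ δ = (Module.finrank k (Ring3 k ⧸ I) : ℚ)))

/-- The degree is uniquely determined. -/
theorem HasDegree.unique {k : Type*} [Field k] {I : Ideal (Ring3 k)} {δ δ' : ℚ}
    (h : HasDegree I δ) (h' : HasDegree I δ') : δ = δ' := by
  obtain ⟨P, hP, hδ⟩ := h
  obtain ⟨Q, hQ, hδ'⟩ := h'
  have hPQ : P = Q := by
    obtain ⟨N, hN⟩ := Filter.eventually_atTop.1 (hP.and hQ)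
    refine Polynomial.eq_of_infinite_eval_eq P Q
      (((Set.Ici_infinite N).image (f := fun n : ℕ => (n : ℚ))
        Nat.cast_injective.injOn).mono ?_)
    rintro _ ⟨n, hn, rfl⟩
    obtain ⟨h₁, h₂⟩ := hN n hn
    exact h₁.symm.trans h₂
  subst hPQ
  rcases hδ with ⟨h₁, h₂⟩ | ⟨h₁, h₂⟩ <;> rcases hδ' with ⟨h₃, h₄⟩ | ⟨h₃, h₄⟩
  · rw [h₂, h₄]
  · exact absurd h₃ h₁
  · exact absurd h₁ h₃
  · rw [h₂, h₄]

/-- The grade of a (proper) ideal: the supremum of the lengths of the regular sequences of the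
ring whose terms lie in the ideal. -/
noncomputable def grade {A : Type*} [CommRing A] (I : Ideal A) : ℕ∞ :=
  ⨆ (rs : List A) (_ : RingTheory.Sequence.IsRegular A rs) (_ : ∀ r ∈ rs, r ∈ I),
    (rs.length : ℕ∞)

/-- A perfect ideal: the projective dimension of `A ⧸ I` equals the grade of `I`. -/
def IsPerfect {A : Type*} [CommRing A] (I : Ideal A) : Prop :=
  CategoryTheory.projectiveDimension (ModuleCat.of A (A ⧸ I)) = ((grade I : ℕ∞) : WithBot ℕ∞)

end Ideals

section Curve

/-! ### Syzygies of the gradient ideal of a plane curve -/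

variable {k : Type*} [Field k]

attribute [local instance] MvPolynomial.gradedAlgebra

/-- The gradient ideal `J_f = (f_x, f_y, f_z)`. -/
noncomputable def gradientIdeal (f : Ring3 k) : Ideal (Ring3 k) :=
  Ideal.span (Set.range fun i : Fin 3 => MvPolynomial.pderiv i f)

/-- `Syz(J_f)`: the triples `g` with `g₀ f_x + g₁ f_y + g₂ f_z = 0`. -/
noncomputable def Syz (f : Ring3 k) : Submodule (Ring3 k) (Fin 3 → Ring3 k) :=
  LinearMap.ker
    (Fintype.linearCombination (Ring3 k) fun i : Fin 3 => MvPolynomial.pderiv i f)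

/-- The grading of `Syz(J_f)` by standard degree: the syzygies of degree `n` are those whose
coordinates are homogeneous of degree `n`. -/
noncomputable def syzGrading (f : Ring3 k) : ℤ → AddSubgroup (Syz f) :=
  subGrading (freeGrading k fun _ : Fin 3 => 0) (Syz f)

/-- `σ` is a (complete) minimal set of homogeneous generators of `Syz(J_f)`, of degrees `a`. -/
structure IsMinimalHomogeneousGenerators (f : Ring3 k) {m : ℕ} (σ : Fin m → Syz f)
    (a : Fin m → ℤ) : Prop where
  homogeneous : ∀ i, σ i ∈ syzGrading f (a i)
  span_eq_top : Submodule.span (Ring3 k) (Set.range σ) = ⊤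
  minimal : ∀ i, Submodule.span (Ring3 k) (σ '' {i}ᶜ) ≠ ⊤

/-- `ε` is a minimal homogeneous generator of degree `e` of `Syz(J_f)`: a member of a minimal set
of homogeneous generators. -/
def IsMinimalHomogeneousGenerator (f : Ring3 k) (ε : Syz f) (e : ℤ) : Prop :=
  ∃ (m : ℕ) (σ : Fin m → Syz f) (a : Fin m → ℤ), IsMinimalHomogeneousGenerators f σ a ∧
    ∃ i, σ i = ε ∧ a i = e

/-- The module `M_ε = coker (ε : R(-e) → Syz(J_f))`. -/
abbrev SyzCoker (f : Ring3 k) (ε : Syz f) := Syz f ⧸ Submodule.span (Ring3 k) {ε}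

/-- `θ` exhibits `I` as a Bourbaki ideal of shift `s` for `ε`: `I` is a proper homogeneous ideal of
codimension two, and `θ` is a homogeneous isomorphism `M_ε ≃ I(s)` of degree zero. -/
structure IsBourbakiIdeal (f : Ring3 k) (ε : Syz f) (s : ℤ) (I : Ideal (Ring3 k))
    (θ : SyzCoker f ε ≃ₗ[Ring3 k] I) : Prop where
  ne_top : I ≠ ⊤
  homogeneous : I.IsHomogeneous (MvPolynomial.homogeneousSubmodule (Fin 3) k)
  height_eq : I.height = 2
  graded : IsGradedIso (quotGrading (syzGrading f) (Submodule.span (Ring3 k) {ε}))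
    (shift (subGrading (ringGrading k) I) s) θ

/-- The module of logarithmic derivations: the `k`-derivations `δ` of `R` with `δ f ∈ (f)`. -/
noncomputable def logDer (f : Ring3 k) :
    Submodule (Ring3 k) (Derivation k (Ring3 k) (Ring3 k)) where
  carrier := {δ | δ f ∈ Ideal.span {f}}
  add_mem' := fun ha hb => (Ideal.span {f}).add_mem ha hb
  zero_mem' := (Ideal.span {f}).zero_mem
  smul_mem' := fun c δ (h : δ f ∈ Ideal.span {f}) => by
    change (c • δ) f ∈ Ideal.span {f}
    rw [Derivation.smul_apply, smul_eq_mul]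
    exact Ideal.mul_mem_left _ c h

/-- `f` is a free divisor: its module of logarithmic derivations is free. -/
def IsFreeDivisor (f : Ring3 k) : Prop := Module.Free (Ring3 k) (logDer f)

/-- The projective curve `V(f)` has a singular point (`k` algebraically closed). -/
def IsSingularCurve (f : Ring3 k) : Prop :=
  ∃ p : Fin 3 → k, p ≠ 0 ∧ MvPolynomial.eval p f = 0 ∧
    ∀ i, MvPolynomial.eval p (MvPolynomial.pderiv i f) = 0

/-- The projective curve `V(f)` is smooth (`k` algebraically closed). -/
def IsSmoothCurve (f : Ring3 k) : Prop := ¬ IsSingularCurve f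

end Curve

end PlaneCurve

open PlaneCurve

/-!
Let `∇f = (f_x, f_y, f_z)`, and let `ε` be a minimal homogeneous generator of the module `Syz` of
syzygies of `∇f`. The argument rests on the following observations.

*The cross product.* For a syzygy `g` both `ε × g` and `∇f` are orthogonal to `ε` and `g`, so they
are proportional. Since `f` is reduced and its degree is
invertible in `k`, the entries of `∇f` have no common prime factor (`exists_not_dvd_grad`), so
`ε × g = h(g) ∇f` for a linear form `h : Syz → R` of degree `e - d` (`exists_bourbakiMap`). By
minimality the entries of `ε` have no common prime factor either, so the kernel of `h` is `R ε`, and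
`h` identifies `M_ε` with a twist of its image. This image contains the entries of `ε`, the values
of `h` at the Koszul syzygies `∇f × v`; hence it is the unit ideal or has height at least two, and
it is the unit ideal as soon as it is free (`eq_top_of_free`).

*Saturation.* If `r₁, r₂, r₃` is a regular sequence and the `rᵢ c` lie in an ideal `I ≃ M_ε`, then
so does `c` (`mem_of_regularTriple_mul_mem`); this is a computation with Koszul cocycles. Applied to
the variables it shows that the irrelevant ideal is not associated to `R ⧸ I`, so that the height of
`I` is at most two and the Hilbert function of `R ⧸ I` does not decrease. Applied to a regular
sequence in `I` and `c = 1` it bounds the grade of `I` by two.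

*Resolutions.* The vanishing of `H₂(x, y, z; Syz)` shows that the minimal generators of the
relations between minimal generators of `Syz` are independent (`injective_of_span_eq_ker`), which
replaces Hilbert's syzygy theorem. By Nakayama's lemma a projective module with a minimal
presentation is free (`injective_of_projective`). As the logarithmic derivations of `f` are the sum
of `R` times the Euler derivation and of `Syz`, this gives the criterion for `f` to be a free
divisor, and the exact projective dimension of `R ⧸ I`.

*Degrees.* Counting dimensions in the sequences `0 → Syz(-d) → R(-d)³ → J_f → 0` and
`0 → R(-e) → Syz → I(e - d) → 0` shows that the Hilbert functions of `R ⧸ I` and `R ⧸ J_f` in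
complementary degrees add up to `d² + e(e - d)` (`hilbertFunction_add_hilbertFunction`). The first
one is monotone and bounded, so both are eventually constant, without any appeal to the existence of
Hilbert polynomials.
-/

namespace PlaneCurve

open MvPolynomial

/-! ### Vectors without a common prime factor -/

section CommonFactor

variable {A : Type*} [CommRing A] [IsDomain A] [UniqueFactorizationMonoid A]

/-- If no prime factor of `a` divides all the entries of `v`, then `a` can be cancelled from the
divisibilities `a ∣ c * v i`. -/
theorem dvd_of_forall_dvd_mul {ι : Type*} [Nonempty ι] {v : ι → A} (a : A) :
    a ≠ 0 → (∀ p, Prime p → p ∣ a → ∃ i, ¬ p ∣ v i) →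
      ∀ c, (∀ i, a ∣ c * v i) → a ∣ c := by
  induction a using UniqueFactorizationMonoid.induction_on_prime with
  | h₁ => intro h; exact absurd rfl h
  | h₂ x hx => intro _ _ c _; exact hx.dvd
  | h₃ a p ha hp ih =>
    intro _ hv c hc
    obtain ⟨i, hi⟩ := hv p hp (dvd_mul_right p a)
    have hpc : p ∣ c := (hp.dvd_or_dvd ((dvd_mul_right p a).trans (hc i))).resolve_right hi
    obtain ⟨c', rfl⟩ := hpc
    refine mul_dvd_mul_left p (ih ha (fun q hq hqa => hv q hq (hqa.mul_left p)) c' fun j => ?_)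
    have := hc j
    rw [mul_assoc] at this
    exact (mul_dvd_mul_iff_left hp.ne_zero).1 this

/-- A vector proportional to a vector `v` whose entries have no common prime factor is a multiple
of `v`. -/
theorem exists_eq_smul_of_proportional {ι : Type*} {v w : ι → A} (hv0 : v ≠ 0)
    (hv : ∀ p, Prime p → ∃ i, ¬ p ∣ v i) (h : ∀ i j, v i * w j = v j * w i) :
    ∃ r : A, w = r • v := by
  obtain ⟨i, hi⟩ := Function.ne_iff.1 hv0
  have : Nonempty ι := ⟨i⟩
  obtain ⟨r, hr⟩ : v i ∣ w i :=
    dvd_of_forall_dvd_mul (v := v) (v i) hi (fun p hp _ => hv p hp) (w i)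
      fun j => ⟨w j, by rw [h i j, mul_comm]⟩
  refine ⟨r, funext fun j => mul_left_cancel₀ hi ?_⟩
  simp only [Pi.smul_apply, smul_eq_mul]
  rw [h i j, hr]
  ring

/-- An ideal containing the entries of a vector without common prime factor has height at least
two. -/
theorem two_le_height_of_mem {ι : Type*} {v : ι → A} (hv0 : v ≠ 0)
    (hv : ∀ p, Prime p → ∃ i, ¬ p ∣ v i) {I : Ideal A} (hI : ∀ i, v i ∈ I) : 2 ≤ I.height := by
  rw [Ideal.height_eq_inf_minimalPrimes]
  refine le_iInf₂ fun P hP => ?_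
  have hPp : P.IsPrime := hP.1.1
  have hvP : ∀ i, v i ∈ P := fun i => hP.1.2 (hI i)
  have hP0 : P ≠ ⊥ := by
    rintro rfl
    exact hv0 (funext fun i => hvP i)
  obtain ⟨p, hpP, hp⟩ := hPp.exists_mem_prime_of_ne_bot hP0
  have hlt : Ideal.span {p} < P := by
    refine lt_of_le_of_ne ((Ideal.span_singleton_le_iff_mem P).2 hpP) fun h => ?_
    obtain ⟨i, hi⟩ := hv p hp
    exact hi (Ideal.mem_span_singleton.1 (h ▸ hvP i))
  have hpp : (Ideal.span {p}).IsPrime := (Ideal.span_singleton_prime hp.ne_zero).2 hp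
  have h1 := Ideal.height_add_one_le_of_lt_of_isPrime hlt
  have h2 : 1 ≤ (Ideal.span {p}).height := by
    have := Ideal.height_add_one_le_of_lt_of_isPrime
      (bot_lt_iff_ne_bot.2 (mt Ideal.span_singleton_eq_bot.1 hp.ne_zero) :
        (⊥ : Ideal A) < Ideal.span {p})
    exact le_trans (by simp) this
  calc (2 : ℕ∞) = 1 + 1 := by norm_num
    _ ≤ _ := add_le_add_left h2 1
    _ ≤ _ := h1

/-- An ideal of height at least two in a noetherian factorial domain contains two nonzero elements
the first of which is a nonzerodivisor modulo the second. -/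
theorem exists_coprime_pair_of_two_le_height [IsNoetherianRing A] {I : Ideal A}
    (hI : 2 ≤ I.height) : ∃ a ∈ I, ∃ b ∈ I, a ≠ 0 ∧ ∀ c, a ∣ b * c → a ∣ c := by
  classical
  have hI0 : I ≠ ⊥ := by
    rintro rfl
    rw [Ideal.height_bot] at hI
    exact absurd hI (by norm_num)
  obtain ⟨a, haI, ha⟩ := Submodule.exists_mem_ne_zero_of_ne_bot hI0
  refine ⟨a, haI, ?_⟩
  let s := (UniqueFactorizationMonoid.factors a).toFinset
  have hs : ∀ q ∈ s, Prime q := fun q hq =>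
    UniqueFactorizationMonoid.prime_of_factor q (Multiset.mem_toFinset.1 hq)
  have hnot : ¬ ((I : Set A) ⊆ ⋃ q ∈ (s : Set A), (Ideal.span {q} : Set A)) := by
    rw [Ideal.subset_union_prime 0 0 fun q hq _ _ =>
      (Ideal.span_singleton_prime (hs q hq).ne_zero).2 (hs q hq)]
    rintro ⟨q, hq, hle⟩
    have hqp : (Ideal.span {q}).IsPrime := (Ideal.span_singleton_prime (hs q hq).ne_zero).2 (hs q hq)
    have hq1 : (Ideal.span {q}).height ≤ 1 :=
      Ideal.height_le_one_of_isPrincipal_of_mem_minimalPrimes (Ideal.span {q}) _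
        (by rw [Ideal.minimalPrimes_eq_subsingleton_self]; rfl)
    exact absurd (hI.trans ((Ideal.height_mono hle).trans hq1)) (by norm_num)
  obtain ⟨b, hbI, hb⟩ := Set.not_subset.1 hnot
  refine ⟨b, hbI, ha, fun c hc => ?_⟩
  refine dvd_of_forall_dvd_mul (v := fun _ : Unit => b) a ha (fun p hp hpa => ⟨(), fun hpb => ?_⟩)
    c fun _ => by rwa [mul_comm]
  obtain ⟨q, hq, hpq⟩ := UniqueFactorizationMonoid.exists_mem_factors_of_dvd ha hp.irreducible hpa
  refine hb (Set.mem_biUnion (Finset.mem_coe.2 (Multiset.mem_toFinset.2 hq)) ?_)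
  exact Ideal.mem_span_singleton.2 (hpq.symm.dvd.trans hpb)

end CommonFactor

/-! ### The gradient of a reduced form -/

section Gradient

variable {k : Type*} [Field k]

/-- The gradient `(f_x, f_y, f_z)` of `f`. -/
noncomputable def grad (f : Ring3 k) : Fin 3 → Ring3 k := fun i => pderiv i f

/-- Over a perfect field, a polynomial whose partial derivatives vanish is either a constant or a
`p`-th power, and hence not prime. -/
theorem not_prime_of_pderiv_eq_zero [IsAlgClosed k] {p : Ring3 k} (h : ∀ i, pderiv i p = 0) :
    ¬ Prime p := by
  intro hp
  obtain ⟨q, hq⟩ := CharP.exists k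
  -- All exponents of `p` are divisible by the characteristic `q` of `k`, which may be zero.
  have hdvd : ∀ m ∈ p.support, ∀ i, q ∣ m i := by
    intro m hm i
    rcases Nat.eq_zero_or_pos (m i) with h0 | h0
    · rw [h0]; exact dvd_zero q
    have h1 := coeff_pderiv (i := i) p (m - Finsupp.single i 1)
    have h2 : m - Finsupp.single i 1 + Finsupp.single i 1 = m :=
      tsub_add_cancel_of_le (Finsupp.single_le_iff.2 h0)
    rw [h i, coeff_zero, h2] at h1
    have h3 := (mul_eq_zero.1 h1.symm).resolve_left (mem_support_iff.1 hm)
    have h4 : (((m - Finsupp.single i 1 : Fin 3 →₀ ℕ) i : ℕ) : k) + 1 = (m i : ℕ) := by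
      have : m i = (m - Finsupp.single i 1 : Fin 3 →₀ ℕ) i + 1 := by
        rw [Finsupp.tsub_apply, Finsupp.single_eq_same]; omega
      rw [this]; push_cast; rfl
    rw [h4] at h3
    exact (CharP.cast_eq_zero_iff k q (m i)).1 h3
  rcases CharP.char_is_prime_or_zero k q with hqp | rfl
  · have : Fact q.Prime := ⟨hqp⟩
    have : ExpChar k q := ExpChar.prime hqp
    have : ExpChar (Ring3 k) q := inferInstance
    have hroot : ∀ c : k, ∃ c' : k, c' ^ q = c := fun c => IsAlgClosed.exists_pow_nat_eq c hqp.pos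
    choose r hr using hroot
    have key : p = (∑ m ∈ p.support,
        monomial (m.mapRange (· / q) (Nat.zero_div q)) (r (coeff m p))) ^ q := by
      rw [sum_pow_char q]
      conv_lhs => rw [p.as_sum]
      refine Finset.sum_congr rfl fun m hm => ?_
      rw [monomial_pow, hr]
      congr 2
      ext i
      simp only [Finsupp.smul_apply, Finsupp.mapRange_apply, smul_eq_mul]
      exact (Nat.mul_div_cancel' (hdvd m hm i)).symm
    rw [key] at hp
    exact not_irreducible_pow hqp.one_lt.ne' hp.irreducible
  · have key : p = C (coeff 0 p) := by
      ext m
      rw [coeff_C]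
      split_ifs with hm
      · rw [hm]
      · by_contra hne
        refine hm (Finsupp.ext fun i => ?_)
        exact (Nat.eq_zero_of_zero_dvd (hdvd m (mem_support_iff.2 hne) i)).symm
    refine hp.not_isUnit ?_
    rw [key]
    refine IsUnit.map C (isUnit_iff_ne_zero.2 fun h0 => hp.ne_zero ?_)
    rw [key, h0, C_0]

/-- The partial derivatives of a polynomial `p` drop the degree, so they are divisible by `p` only
if they vanish. -/
theorem pderiv_eq_zero_of_dvd {p : Ring3 k} {i : Fin 3} (h : p ∣ pderiv i p) :
    pderiv i p = 0 := by
  by_contra hne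
  obtain ⟨m, hm, hdeg⟩ := Finset.exists_mem_eq_sup (pderiv i p).support
    (support_nonempty.2 hne) fun s => s.sum fun _ e => e
  have hle : p.totalDegree ≤ (pderiv i p).totalDegree := totalDegree_le_of_dvd_of_isDomain h hne
  have hm' : coeff (m + Finsupp.single i 1) p ≠ 0 := by
    intro h0
    rw [mem_support_iff, coeff_pderiv, h0, zero_mul] at hm
    exact hm rfl
  have hlt := le_totalDegree (mem_support_iff.2 hm')
  rw [Finsupp.sum_add_index' (fun _ => rfl) (fun _ _ _ => rfl), Finsupp.sum_single_index rfl] at hlt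
  have : (pderiv i p).totalDegree = m.sum fun _ e => e := hdeg
  omega

theorem sum_X_mul_grad {f : Ring3 k} {n : ℕ} (hf : f.IsHomogeneous n) :
    ∑ i, X i * grad f i = (n : Ring3 k) * f := by
  have := hf.sum_X_mul_pderiv
  rw [nsmul_eq_mul] at this
  exact this

/-- The partial derivatives of a reduced form have no common prime factor. -/
theorem exists_not_dvd_grad [IsAlgClosed k] {f : Ring3 k} {n : ℕ} (hn : (n : k) ≠ 0)
    (hf0 : f ≠ 0) (hf : f.IsHomogeneous n) (hred : (Ideal.span {f}).IsRadical) (p : Ring3 k)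
    (hp : Prime p) : ∃ i, ¬ p ∣ grad f i := by
  by_contra! hall
  have hpf : p ∣ f := by
    have h1 : p ∣ (n : Ring3 k) * f := by
      rw [← sum_X_mul_grad hf]
      exact Finset.dvd_sum fun i _ => (hall i).mul_left _
    have hu : IsUnit (n : Ring3 k) := by
      rw [← map_natCast (C : k →+* Ring3 k)]
      exact IsUnit.map C (isUnit_iff_ne_zero.2 hn)
    exact hu.dvd_mul_left.1 h1
  obtain ⟨g, rfl⟩ := hpf
  -- Since `f = p g` is reduced, `p` divides `∂p / ∂x_i` for each `i`.
  have hpg : ¬ p ∣ g := by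
    rintro ⟨g', rfl⟩
    have h2 : p * g' ∈ Ideal.span {p * (p * g')} :=
      hred ⟨2, Ideal.mem_span_singleton.2 ⟨g', by ring⟩⟩
    obtain ⟨c, hc⟩ := Ideal.mem_span_singleton.1 h2
    have hpg0 : p * g' ≠ 0 := right_ne_zero_of_mul hf0
    refine hp.not_isUnit (IsUnit.of_mul_eq_one c (mul_left_cancel₀ hpg0 ?_))
    rw [mul_one]
    conv_rhs => rw [hc]
    ring
  refine not_prime_of_pderiv_eq_zero (fun i => pderiv_eq_zero_of_dvd ?_) hp
  have h3 := hall i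
  rw [grad, pderiv_mul] at h3
  exact (hp.dvd_or_dvd ((dvd_add_left (dvd_mul_right p _)).1 h3)).resolve_right hpg

theorem grad_ne_zero {f : Ring3 k} {n : ℕ} (hn : (n : k) ≠ 0) (hf0 : f ≠ 0)
    (hf : f.IsHomogeneous n) : grad f ≠ 0 := by
  intro h
  have h1 := sum_X_mul_grad hf
  simp only [h, Pi.zero_apply, mul_zero, Finset.sum_const_zero] at h1
  rcases mul_eq_zero.1 h1.symm with h2 | h2
  · rw [← map_natCast (C : k →+* Ring3 k), C_eq_zero] at h2
    exact hn h2
  · exact hf0 h2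

end Gradient

/-! ### Koszul exactness for a regular sequence of three elements -/

section Koszul

/-- `r₁, r₂, r₃` is a weakly regular sequence of a domain, in divisibility form. -/
structure IsRegularTriple {A : Type*} [CommRing A] (r₁ r₂ r₃ : A) : Prop where
  ne_zero : r₁ ≠ 0
  dvd : ∀ c, r₁ ∣ r₂ * c → r₁ ∣ c
  mem : ∀ c, r₃ * c ∈ Ideal.span {r₁, r₂} → c ∈ Ideal.span {r₁, r₂}

theorem IsRegularTriple.koszul {A : Type*} [CommRing A] [IsDomain A] {r₁ r₂ r₃ : A}
    (h : IsRegularTriple r₁ r₂ r₃) {a b c : A} (habc : r₁ * a + r₂ * b + r₃ * c = 0) :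
    ∃ p q s, a = r₂ * p + r₃ * q ∧ b = -(r₁ * p) + r₃ * s ∧ c = -(r₁ * q) - r₂ * s := by
  obtain ⟨u, v, huv⟩ := Ideal.mem_span_pair.1 (h.mem c
    (Ideal.mem_span_pair.2 ⟨-a, -b, by linear_combination -habc⟩))
  obtain ⟨w, hw⟩ := h.dvd (b + r₃ * v) ⟨-(a + r₃ * u), by linear_combination habc + r₃ * huv⟩
  refine ⟨-w, -u, -v, mul_left_cancel₀ h.ne_zero ?_, by linear_combination hw,
    by linear_combination -huv⟩
  linear_combination habc + r₃ * huv - r₂ * hw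

theorem isRegularTriple_of_isWeaklyRegular {A : Type*} [CommRing A] [IsDomain A] {r₁ r₂ r₃ : A}
    {l : List A} (h : RingTheory.Sequence.IsWeaklyRegular A (r₁ :: r₂ :: r₃ :: l)) :
    IsRegularTriple r₁ r₂ r₃ := by
  have aux : ∀ (J : Ideal A) (r : A), IsSMulRegular (A ⧸ (J • ⊤ : Ideal A)) r →
      ∀ c, r * c ∈ J → c ∈ J := by
    intro J r hr c hc
    have hJ : ∀ x : A, x ∈ (J • ⊤ : Ideal A) ↔ x ∈ J := fun x => by
      rw [smul_eq_mul, Ideal.mul_top]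
    rw [← hJ, ← Ideal.Quotient.eq_zero_iff_mem]
    refine hr ?_
    change r • Ideal.Quotient.mk _ c = r • 0
    rw [smul_zero, ← Ideal.Quotient.eq_zero_iff_mem.2 ((hJ _).2 hc)]
    rfl
  have h1 := aux _ _ (h.regular_mod_prev 0 (by simp))
  have h2 := aux _ _ (h.regular_mod_prev 1 (by simp))
  have h3 := aux _ _ (h.regular_mod_prev 2 (by simp))
  simp only [List.take_zero, Ideal.ofList_nil, List.getElem_cons_zero, List.take_succ_cons,
    List.getElem_cons_succ, Ideal.ofList_cons, sup_bot_eq] at h1 h2 h3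
  refine ⟨?_, fun c hc => ?_, fun c hc => ?_⟩
  · rintro rfl
    have : (1 : A) ∈ (⊥ : Ideal A) := h1 1 (by simp)
    exact one_ne_zero this
  · exact Ideal.mem_span_singleton.1 (h2 c (Ideal.mem_span_singleton.2 hc))
  · rw [Ideal.span_insert] at hc ⊢
    exact h3 c hc

theorem isRegularTriple_X {k : Type*} [Field k] :
    IsRegularTriple (X 0 : Ring3 k) (X 1) (X 2) := by
  have hpair : ({X 0, X 1} : Set (Ring3 k)) = X '' {0, 1} := by rw [Set.image_pair]
  refine ⟨X_ne_zero 0, fun c hc => ?_, fun c hc => ?_⟩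
  · refine ((X_prime (i := (0 : Fin 3))).dvd_or_dvd hc).resolve_left ?_
    rw [X_dvd_X]
    simp
  · rw [hpair, mem_ideal_span_X_image] at hc ⊢
    intro m hm
    obtain ⟨i, hi, hmi⟩ := hc (m + Finsupp.single 2 1) (by
      rw [mem_support_iff, mul_comm, coeff_mul_X]; exact mem_support_iff.1 hm)
    refine ⟨i, hi, ?_⟩
    have h2 : (2 : Fin 3) ≠ i := by rintro rfl; simp at hi
    rwa [Finsupp.add_apply, Finsupp.single_eq_of_ne h2.symm, add_zero] at hmi

end Koszul

/-! ### Homogeneous components indexed by the integers -/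

section Components

variable {k : Type*} [Field k]

/-- The homogeneous component of degree `n : ℤ` of a polynomial; it is zero for `n < 0`. -/
noncomputable def comp (n : ℤ) : Ring3 k →ₗ[k] Ring3 k :=
  if 0 ≤ n then homogeneousComponent n.toNat else 0

theorem coeff_comp (n : ℤ) (p : Ring3 k) (m : Fin 3 →₀ ℕ) :
    coeff m (comp n p) = if (m.degree : ℤ) = n then coeff m p else 0 := by
  unfold comp
  split_ifs with h1 h2 h2
  · rw [coeff_homogeneousComponent, if_pos (by omega)]
  · rw [coeff_homogeneousComponent, if_neg (by omega)]
  · omega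
  · rfl

theorem mem_ringGrading {n : ℤ} {p : Ring3 k} :
    p ∈ ringGrading k n ↔ ∀ m, coeff m p ≠ 0 → (m.degree : ℤ) = n := by
  unfold ringGrading
  split_ifs with h
  · rw [Submodule.mem_toAddSubgroup, mem_homogeneousSubmodule, IsHomogeneous,
      IsWeightedHomogeneous]
    refine forall₂_congr fun m _ => ?_
    rw [show Finsupp.weight (1 : Fin 3 → ℕ) m = m.degree by
      rw [Finsupp.degree_eq_weight_one]; rfl]
    omega
  · rw [AddSubgroup.mem_bot]
    constructor
    · rintro rfl m hm
      exact absurd (coeff_zero m) hm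
    · intro hp
      ext m
      by_contra hm
      have := hp m hm
      omega

theorem mem_ringGrading_natCast {n : ℕ} {p : Ring3 k} :
    p ∈ ringGrading k (n : ℤ) ↔ p.IsHomogeneous n := by
  unfold ringGrading
  rw [if_pos (Int.natCast_nonneg n), Submodule.mem_toAddSubgroup, Int.toNat_natCast,
    mem_homogeneousSubmodule]

theorem comp_mem (n : ℤ) (p : Ring3 k) : comp n p ∈ ringGrading k n := by
  rw [mem_ringGrading]
  intro m hm
  rw [coeff_comp] at hm
  by_contra h
  exact hm (if_neg h)

theorem comp_eq_self_iff {n : ℤ} {p : Ring3 k} : comp n p = p ↔ p ∈ ringGrading k n := by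
  refine ⟨fun h => h ▸ comp_mem n p, fun h => ?_⟩
  ext m
  rw [coeff_comp]
  split_ifs with hm
  · rfl
  · by_contra hne
    exact hm (mem_ringGrading.1 h m (Ne.symm hne))

theorem comp_mul {n d : ℤ} (p : Ring3 k) {w : Ring3 k} (hw : w ∈ ringGrading k d) :
    comp n (p * w) = comp (n - d) p * w := by
  ext m
  rw [coeff_comp, coeff_mul, coeff_mul]
  have key : ∀ x ∈ Finset.HasAntidiagonal.antidiagonal m, coeff x.1 (comp (n - d) p) * coeff x.2 w =
      if (m.degree : ℤ) = n then coeff x.1 p * coeff x.2 w else 0 := by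
    intro x hx
    by_cases h0 : coeff x.2 w = 0
    · simp [h0]
    have h1 := mem_ringGrading.1 hw x.2 h0
    have h2 : x.1.degree + x.2.degree = m.degree := by
      rw [← map_add, Finset.HasAntidiagonal.mem_antidiagonal.1 hx]
    rw [coeff_comp]
    by_cases h3 : (m.degree : ℤ) = n
    · rw [if_pos h3, if_pos (by omega)]
    · rw [if_neg h3, if_neg (by omega), zero_mul]
  rw [Finset.sum_congr rfl key]
  split_ifs
  · rfl
  · simp

theorem mul_mem_ringGrading {n d : ℤ} {p w : Ring3 k} (hp : p ∈ ringGrading k n)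
    (hw : w ∈ ringGrading k d) : p * w ∈ ringGrading k (n + d) := by
  rw [← comp_eq_self_iff, comp_mul p hw, add_sub_cancel_right, comp_eq_self_iff.2 hp]

/-- If `p * w` is homogeneous and `w` is a nonzero homogeneous polynomial, then `p` is
homogeneous. -/
theorem mem_ringGrading_of_mul_mem {n d : ℤ} {p w : Ring3 k} (hw : w ∈ ringGrading k d)
    (hw0 : w ≠ 0) (h : p * w ∈ ringGrading k n) : p ∈ ringGrading k (n - d) := by
  rw [← comp_eq_self_iff] at h ⊢
  rw [comp_mul p hw] at h
  exact mul_right_cancel₀ hw0 h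

theorem comp_zero (p : Ring3 k) : comp 0 p = C (constantCoeff p) := by
  ext m
  rw [coeff_comp, coeff_C, constantCoeff_eq]
  by_cases hm : m = 0
  · subst hm; simp
  · rw [if_neg, if_neg (Ne.symm hm)]
    intro h
    exact hm ((Finsupp.degree_eq_zero_iff m).1 (by exact_mod_cast h))

theorem mem_irrelevant {p : Ring3 k} : p ∈ irrelevant k ↔ constantCoeff p = 0 := by
  rw [irrelevant, ← Set.image_univ, mem_ideal_span_X_image, constantCoeff_eq]
  constructor
  · intro h
    by_contra h0
    obtain ⟨i, -, hi⟩ := h 0 (mem_support_iff.2 h0)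
    exact hi rfl
  · intro h m hm
    have : m ≠ 0 := by
      rintro rfl
      exact mem_support_iff.1 hm h
    obtain ⟨i, hi⟩ := Finsupp.ne_iff.1 this
    exact ⟨i, Set.mem_univ i, hi⟩

/-- The part of degree `n` of an element of the graded free module `⨁ i, R(-a i)`. -/
noncomputable def vcomp {ι : Type*} (a : ι → ℤ) (n : ℤ) : (ι → Ring3 k) →ₗ[k] (ι → Ring3 k) :=
  LinearMap.pi fun i => comp (n - a i) ∘ₗ LinearMap.proj i

variable {ι κ : Type*} {a : ι → ℤ}

@[simp] theorem vcomp_apply (n : ℤ) (v : ι → Ring3 k) (i : ι) :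
    vcomp a n v i = comp (n - a i) (v i) := rfl

theorem mem_freeGrading {n : ℤ} {v : ι → Ring3 k} :
    v ∈ freeGrading k a n ↔ ∀ i, v i ∈ ringGrading k (n - a i) := by
  simp [freeGrading, AddSubgroup.mem_pi]

theorem vcomp_mem (n : ℤ) (v : ι → Ring3 k) : vcomp a n v ∈ freeGrading k a n :=
  mem_freeGrading.2 fun _ => comp_mem _ _

theorem vcomp_eq_self_iff {n : ℤ} {v : ι → Ring3 k} :
    vcomp a n v = v ↔ v ∈ freeGrading k a n := by
  rw [mem_freeGrading, funext_iff]
  exact forall_congr' fun i => comp_eq_self_iff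

theorem vcomp_smul {n b : ℤ} (c : Ring3 k) {v : ι → Ring3 k} (hv : v ∈ freeGrading k a b) :
    vcomp a n (c • v) = comp (n - b) c • v := by
  funext i
  simp only [vcomp_apply, Pi.smul_apply, smul_eq_mul]
  rw [comp_mul c (mem_freeGrading.1 hv i), sub_sub_sub_cancel_right]

theorem vcomp_linearCombination [Fintype κ] {τ : κ → ι → Ring3 k} {b : κ → ℤ}
    (hτ : ∀ j, τ j ∈ freeGrading k a (b j)) (n : ℤ) (c : κ → Ring3 k) :
    vcomp a n (Fintype.linearCombination (Ring3 k) τ c) =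
      Fintype.linearCombination (Ring3 k) τ (vcomp b n c) := by
  simp only [Fintype.linearCombination_apply, map_sum, vcomp_apply]
  exact Finset.sum_congr rfl fun j _ => vcomp_smul _ (hτ j)

theorem sum_comp_eq_self (c : ℤ) (p : Ring3 k) {s : Finset ℤ}
    (hs : Finset.Icc c (p.totalDegree + c) ⊆ s) : ∑ n ∈ s, comp (n - c) p = p := by
  ext m
  rw [coeff_sum]
  simp only [coeff_comp]
  by_cases hm : coeff m p = 0
  · simp [hm]
  have hdeg : m.degree ≤ p.totalDegree := le_totalDegree (mem_support_iff.2 hm)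
  rw [Finset.sum_eq_single ((m.degree : ℤ) + c)]
  · rw [if_pos (by ring)]
  · intro n _ hn
    exact if_neg fun h => hn (by rw [h]; ring)
  · intro h
    exact absurd (hs (Finset.mem_Icc.2 ⟨by omega, by omega⟩)) h

theorem exists_sum_vcomp_eq_self [Fintype ι] (a : ι → ℤ) (v : ι → Ring3 k) :
    ∃ s : Finset ℤ, ∑ n ∈ s, vcomp a n v = v := by
  classical
  refine ⟨Finset.univ.biUnion fun i => Finset.Icc (a i) ((v i).totalDegree + a i),
    funext fun i => ?_⟩
  rw [Finset.sum_apply]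
  exact sum_comp_eq_self (a i) (v i) (Finset.subset_biUnion_of_mem
    (fun i => Finset.Icc (a i) ((v i).totalDegree + a i)) (Finset.mem_univ i))

end Components

/-! ### Minimal homogeneous generators of graded submodules of free modules -/

section MinimalGenerators

variable {k : Type*} [Field k] {ι : Type*} {a : ι → ℤ}

/-- A submodule of `⨁ i, R(-a i)` is graded: it contains the homogeneous parts of its elements. -/
def IsGradedSubmodule (a : ι → ℤ) (N : Submodule (Ring3 k) (ι → Ring3 k)) : Prop :=
  ∀ v ∈ N, ∀ n, vcomp a n v ∈ N

theorem isGradedSubmodule_ker {κ : Type*} [Fintype κ] {τ : κ → ι → Ring3 k} {b : κ → ℤ}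
    (hτ : ∀ j, τ j ∈ freeGrading k a (b j)) :
    IsGradedSubmodule b (LinearMap.ker (Fintype.linearCombination (Ring3 k) τ)) := by
  intro v hv n
  rw [LinearMap.mem_ker] at hv ⊢
  rw [← vcomp_linearCombination hτ, hv, map_zero]

/-- Every graded submodule of a finitely generated graded free module has a minimal finite family
of homogeneous generators. -/
theorem exists_minimal_generators [Fintype ι] {N : Submodule (Ring3 k) (ι → Ring3 k)}
    (hN : IsGradedSubmodule a N) :
    ∃ (n : ℕ) (τ : Fin n → ι → Ring3 k) (b : Fin n → ℤ),
      (∀ j, τ j ∈ freeGrading k a (b j)) ∧ Submodule.span (Ring3 k) (Set.range τ) = N ∧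
        ∀ j, τ j ∉ Submodule.span (Ring3 k) (τ '' {j}ᶜ) := by
  classical
  let P : ℕ → Prop := fun n => ∃ (τ : Fin n → ι → Ring3 k) (b : Fin n → ℤ),
    (∀ j, τ j ∈ freeGrading k a (b j)) ∧ Submodule.span (Ring3 k) (Set.range τ) = N
  have hP : ∃ n, P n := by
    -- The homogeneous elements of `N` generate it, and finitely many of them suffice.
    let S : Set (ι → Ring3 k) := {v | v ∈ N ∧ ∃ n, v ∈ freeGrading k a n}
    have hS : Submodule.span (Ring3 k) S = N := by
      refine le_antisymm (Submodule.span_le.2 fun v hv => hv.1) fun v hv => ?_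
      obtain ⟨s, hs⟩ := exists_sum_vcomp_eq_self a v
      rw [← hs]
      exact Submodule.sum_mem _ fun n _ =>
        Submodule.subset_span ⟨hN v hv n, n, vcomp_mem n v⟩
    obtain ⟨T, hTS, hT⟩ := (Submodule.fg_span_iff_fg_span_finset_subset S).1
      (by rw [hS]; exact IsNoetherian.noetherian N)
    choose! b hb using fun v (hv : v ∈ S) => hv.2
    let q : Fin T.card → ι → Ring3 k := fun j => (T.equivFin.symm j : ι → Ring3 k)
    refine ⟨T.card, q, fun j => b (q j), fun j => hb _ (hTS (T.equivFin.symm j).2), ?_⟩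
    rw [← hS, hT]
    congr 1
    ext v
    constructor
    · rintro ⟨j, rfl⟩
      exact (T.equivFin.symm j).2
    · intro hv
      exact ⟨T.equivFin ⟨v, hv⟩, by simp [q]⟩
  -- A homogeneous generating family of least possible length is minimal.
  obtain ⟨τ, b, hb, hspan⟩ := Nat.find_spec hP
  refine ⟨Nat.find hP, τ, b, hb, hspan, ?_⟩
  have hmin : ∀ m, P m → Nat.find hP ≤ m := fun m hm => Nat.find_min' hP hm
  generalize Nat.find hP = n at τ b hb hspan hmin
  intro j hj
  cases n with
  | zero => exact j.elim0
  | succ n =>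
    have h1 : P n := by
      refine ⟨τ ∘ j.succAbove, b ∘ j.succAbove, fun i => hb _, ?_⟩
      rw [Set.range_comp, Fin.range_succAbove, ← hspan]
      refine le_antisymm (Submodule.span_mono (Set.image_subset_range _ _))
        (Submodule.span_le.2 ?_)
      rintro _ ⟨i, rfl⟩
      by_cases hij : i = j
      · rw [hij]; exact hj
      · exact Submodule.subset_span ⟨i, hij, rfl⟩
    have := hmin n h1
    omega

/-- The relations between minimal homogeneous generators have coefficients in the irrelevant
ideal. -/
theorem constantCoeff_eq_zero_of_relation {n : ℕ} {τ : Fin n → ι → Ring3 k} {b : Fin n → ℤ}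
    (hτ : ∀ j, τ j ∈ freeGrading k a (b j))
    (hmin : ∀ j, τ j ∉ Submodule.span (Ring3 k) (τ '' {j}ᶜ)) {c : Fin n → Ring3 k}
    (hc : Fintype.linearCombination (Ring3 k) τ c = 0) (j : Fin n) : constantCoeff (c j) = 0 := by
  by_contra hu
  -- In the degree of `τ j`, the relation expresses `τ j` through the other generators.
  have h1 := vcomp_linearCombination hτ (b j) c
  rw [hc, map_zero, Fintype.linearCombination_apply, ← Finset.add_sum_erase _ _ (Finset.mem_univ j),
    vcomp_apply, sub_self, comp_zero] at h1
  have h2 : ∑ i ∈ Finset.univ.erase j, vcomp b (b j) c i • τ i ∈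
      Submodule.span (Ring3 k) (τ '' {j}ᶜ) :=
    Submodule.sum_mem _ fun i hi => Submodule.smul_mem _ _
      (Submodule.subset_span ⟨i, Finset.ne_of_mem_erase hi, rfl⟩)
  refine hmin j ?_
  have h3 : τ j = (C (-(constantCoeff (c j))⁻¹) : Ring3 k) •
      ∑ i ∈ Finset.univ.erase j, vcomp b (b j) c i • τ i := by
    rw [eq_neg_of_add_eq_zero_right h1.symm, smul_neg, smul_smul, ← C_mul, neg_mul,
      inv_mul_cancel₀ hu, C_neg, C_1, neg_smul, one_smul, neg_neg]
  rw [h3]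
  exact Submodule.smul_mem _ _ h2

theorem mem_irrelevant_smul_top {n : ℕ} {v : Fin n → Ring3 k} :
    v ∈ irrelevant k • (⊤ : Submodule (Ring3 k) (Fin n → Ring3 k)) ↔
      ∀ j, constantCoeff (v j) = 0 := by
  constructor
  · intro hv
    induction hv using Submodule.smul_induction_on' with
    | smul r hr x _ =>
      intro j
      rw [Pi.smul_apply, smul_eq_mul, map_mul, mem_irrelevant.1 hr, zero_mul]
    | add x _ y _ hx hy =>
      intro j
      rw [Pi.add_apply, map_add, hx j, hy j, add_zero]
  · intro h
    rw [pi_eq_sum_univ' v]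
    exact Submodule.sum_mem _ fun j _ =>
      Submodule.smul_mem_smul (mem_irrelevant.2 (h j)) Submodule.mem_top

/-- A finitely generated submodule `K` of a free module with `K ⊆ 𝔪 K` vanishes. -/
theorem eq_bot_of_le_irrelevant_smul {κ : Type*} [Finite κ]
    {K : Submodule (Ring3 k) (κ → Ring3 k)} (h : K ≤ irrelevant k • K) : K = ⊥ := by
  obtain ⟨r, hr, hK⟩ := Submodule.exists_sub_one_mem_and_smul_eq_zero_of_fg_of_le_smul
    (irrelevant k) K (IsNoetherian.noetherian K) h
  have hr0 : r ≠ 0 := by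
    rintro rfl
    rw [mem_irrelevant] at hr
    simp at hr
  exact (Submodule.eq_bot_iff K).2 fun v hv => (smul_eq_zero.1 (hK v hv)).resolve_left hr0

/-- A presentation of a projective module with relations in `𝔪` times a free module is an
isomorphism. -/
theorem injective_of_projective {n : ℕ} {M : Type*} [AddCommGroup M] [Module (Ring3 k) M]
    [Module.Projective (Ring3 k) M] (φ : (Fin n → Ring3 k) →ₗ[Ring3 k] M)
    (hφ : Function.Surjective φ) (hmin : ∀ v, φ v = 0 → ∀ j, constantCoeff (v j) = 0) :
    Function.Injective φ := by
  obtain ⟨s, hs⟩ := Module.projective_lifting_property φ LinearMap.id hφ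
  rw [← LinearMap.ker_eq_bot]
  refine eq_bot_of_le_irrelevant_smul fun u hu => ?_
  have hu' : φ u = 0 := hu
  -- The projection onto the kernel maps `u ∈ 𝔪 F` into `𝔪 • ker φ`.
  let π : (Fin n → Ring3 k) →ₗ[Ring3 k] (Fin n → Ring3 k) := LinearMap.id - s ∘ₗ φ
  have hπ : ∀ v, π v ∈ LinearMap.ker φ := fun v => by
    have : φ (s (φ v)) = φ v := LinearMap.congr_fun hs (φ v)
    simp [π, this]
  have hπu : π u = u := by simp [π, hu']
  rw [← hπu, pi_eq_sum_univ' u, map_sum]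
  refine Submodule.sum_mem _ fun j _ => ?_
  rw [map_smul]
  exact Submodule.smul_mem_smul (mem_irrelevant.2 (hmin u hu' j)) (hπ _)

end MinimalGenerators

attribute [local instance] MvPolynomial.gradedAlgebra

/-! ### The graded module of syzygies of the gradient -/

section Syzygies

variable {k : Type*} [Field k] {f : Ring3 k}

theorem mem_Syz {g : Fin 3 → Ring3 k} : g ∈ Syz f ↔ ∑ i, g i * grad f i = 0 := by
  rw [Syz, LinearMap.mem_ker, Fintype.linearCombination_apply]
  rfl

theorem sum_syz_mul_grad (g : Syz f) :
    g.1 0 * grad f 0 + g.1 1 * grad f 1 + g.1 2 * grad f 2 = 0 := by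
  have := mem_Syz.1 g.2
  rwa [Fin.sum_univ_three] at this

theorem mem_Syz_of_smul_mem {r : Ring3 k} (hr : r ≠ 0) {v : Fin 3 → Ring3 k}
    (h : r • v ∈ Syz f) : v ∈ Syz f := by
  rw [Syz, LinearMap.mem_ker] at h ⊢
  rw [map_smul] at h
  exact (smul_eq_zero.1 h).resolve_left hr

theorem grad_mem_ringGrading {d : ℕ} (hf : f.IsHomogeneous (d + 1)) (i : Fin 3) :
    grad f i ∈ ringGrading k (d : ℤ) :=
  mem_ringGrading_natCast.2 hf.pderiv

theorem mem_syzGrading {n : ℤ} {g : Syz f} :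
    g ∈ syzGrading f n ↔ g.1 ∈ freeGrading k (fun _ : Fin 3 => (0 : ℤ)) n := Iff.rfl

theorem mem_syzGrading_iff {n : ℤ} {g : Syz f} :
    g ∈ syzGrading f n ↔ ∀ i, g.1 i ∈ ringGrading k n := by
  simp only [mem_syzGrading, mem_freeGrading, sub_zero]

theorem isGradedSubmodule_Syz {d : ℤ} (hgrad : ∀ i, grad f i ∈ ringGrading k d) :
    IsGradedSubmodule (fun _ : Fin 3 => (0 : ℤ)) (Syz f) := by
  intro v hv n
  rw [mem_Syz] at hv ⊢
  have h1 := congrArg (comp (n + d)) hv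
  rw [map_sum, map_zero] at h1
  rw [← h1]
  refine Finset.sum_congr rfl fun i _ => ?_
  rw [comp_mul _ (hgrad i), vcomp_apply, sub_zero, add_sub_cancel_right]

/-- The homogeneous part of degree `n` of a syzygy. -/
noncomputable def syzComp {d : ℤ} (hgrad : ∀ i, grad f i ∈ ringGrading k d) (n : ℤ) (g : Syz f) :
    Syz f :=
  ⟨vcomp (fun _ => 0) n g.1, isGradedSubmodule_Syz hgrad g.1 g.2 n⟩

theorem syzComp_mem {d : ℤ} (hgrad : ∀ i, grad f i ∈ ringGrading k d) (n : ℤ) (g : Syz f) :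
    syzComp hgrad n g ∈ syzGrading f n :=
  mem_syzGrading.2 (vcomp_mem n g.1)

theorem syzComp_eq_self {d : ℤ} (hgrad : ∀ i, grad f i ∈ ringGrading k d) {n : ℤ} {g : Syz f}
    (hg : g ∈ syzGrading f n) : syzComp hgrad n g = g :=
  Subtype.ext (vcomp_eq_self_iff.2 (mem_syzGrading.1 hg))

end Syzygies

/-! ### Minimal generators of the syzygy module -/

section SyzygyGenerators

variable {k : Type*} [Field k] {f : Ring3 k}

theorem coe_linearCombination {m : ℕ} (σ : Fin m → Syz f) (c : Fin m → Ring3 k) :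
    (Fintype.linearCombination (Ring3 k) σ c : Fin 3 → Ring3 k) =
      Fintype.linearCombination (Ring3 k) (fun i => (σ i : Fin 3 → Ring3 k)) c := by
  simp [Fintype.linearCombination_apply]

namespace IsMinimalHomogeneousGenerators

variable {m : ℕ} {σ : Fin m → Syz f} {a : Fin m → ℤ}

theorem mem_freeGrading (h : IsMinimalHomogeneousGenerators f σ a) (i : Fin m) :
    (σ i : Fin 3 → Ring3 k) ∈ freeGrading k (fun _ : Fin 3 => (0 : ℤ)) (a i) :=
  h.homogeneous i

theorem notMem_span (h : IsMinimalHomogeneousGenerators f σ a) (i : Fin m) :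
    (σ i : Fin 3 → Ring3 k) ∉
      Submodule.span (Ring3 k) ((fun i => (σ i : Fin 3 → Ring3 k)) '' {i}ᶜ) := by
  intro hi
  have h1 : (fun i => (σ i : Fin 3 → Ring3 k)) '' {i}ᶜ = (Syz f).subtype '' (σ '' {i}ᶜ) := by
    rw [← Set.image_comp]; rfl
  rw [h1, ← Submodule.map_span] at hi
  obtain ⟨x, hx, hxi⟩ := hi
  have hxi' : x = σ i := Subtype.ext hxi
  refine h.minimal i (eq_top_iff.2 ?_)
  rw [← h.span_eq_top]
  refine Submodule.span_le.2 ?_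
  rintro _ ⟨j, rfl⟩
  by_cases hij : j = i
  · rw [hij, ← hxi']; exact hx
  · exact Submodule.subset_span ⟨j, hij, rfl⟩

theorem constantCoeff_eq_zero (h : IsMinimalHomogeneousGenerators f σ a) {c : Fin m → Ring3 k}
    (hc : Fintype.linearCombination (Ring3 k) σ c = 0) (j : Fin m) : constantCoeff (c j) = 0 :=
  constantCoeff_eq_zero_of_relation h.mem_freeGrading h.notMem_span
    (by rw [← coe_linearCombination, hc]; rfl) j

theorem surjective (h : IsMinimalHomogeneousGenerators f σ a) :
    Function.Surjective (Fintype.linearCombination (Ring3 k) σ) := by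
  rw [← LinearMap.range_eq_top, Fintype.range_linearCombination]
  exact h.span_eq_top

theorem ne_zero (h : IsMinimalHomogeneousGenerators f σ a) (i : Fin m) : σ i ≠ 0 := by
  intro h0
  refine h.notMem_span i ?_
  rw [h0]
  exact Submodule.zero_mem _

end IsMinimalHomogeneousGenerators

/-- A minimal homogeneous generator can be taken as the first one of a minimal family of
homogeneous generators. -/
theorem IsMinimalHomogeneousGenerator.exists_zero {ε : Syz f} {e : ℤ}
    (hε : IsMinimalHomogeneousGenerator f ε e) :
    ∃ (m : ℕ) (σ : Fin (m + 1) → Syz f) (a : Fin (m + 1) → ℤ),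
      IsMinimalHomogeneousGenerators f σ a ∧ σ 0 = ε ∧ a 0 = e := by
  obtain ⟨m, σ, a, h, i, hi, hai⟩ := hε
  cases m with
  | zero => exact i.elim0
  | succ m =>
    let s := Equiv.swap 0 i
    refine ⟨m, σ ∘ s, a ∘ s, ⟨fun j => h.homogeneous _, ?_, fun j => ?_⟩, ?_, ?_⟩
    · rw [s.surjective.range_comp]
      exact h.span_eq_top
    · rw [Set.image_comp, Set.image_compl_eq s.bijective, Set.image_singleton]
      exact h.minimal _
    · simpa [s] using hi
    · simpa [s] using hai

/-- A prime polynomial dividing a nonzero form has no constant term, because the largest homogeneous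
ideal in `(p)` is a nonzero prime ideal, and hence equal to `(p)`. -/
theorem constantCoeff_eq_zero_of_prime_dvd {n : ℤ} {p w : Ring3 k} (hp : Prime p) (hw0 : w ≠ 0)
    (hw : w ∈ ringGrading k n) (hpw : p ∣ w) : constantCoeff p = 0 := by
  have hP : (Ideal.span {p}).IsPrime := (Ideal.span_singleton_prime hp.ne_zero).2 hp
  have hn : 0 ≤ n := by
    by_contra h
    rw [ringGrading, if_neg h] at hw
    exact hw0 hw
  lift n to ℕ using hn
  let Q := Ideal.homogeneousCore (homogeneousSubmodule (Fin 3) k) (Ideal.span {p})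
  have hQ : Q.toIdeal.IsPrime := hP.homogeneousCore
  have hQle : Q.toIdeal ≤ Ideal.span {p} := Ideal.toIdeal_homogeneousCore_le _ _
  have hwQ : w ∈ Q.toIdeal := Ideal.mem_homogeneousCore_of_homogeneous_of_mem
    ⟨n, mem_ringGrading_natCast.1 hw⟩ (Ideal.mem_span_singleton.2 hpw)
  obtain ⟨q, hqQ, hq⟩ := hQ.exists_mem_prime_of_ne_bot (fun h => hw0 (by rwa [h] at hwQ))
  have hpq : Associated p q := hp.associated_of_dvd hq (Ideal.mem_span_singleton.1 (hQle hqQ))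
  have hpQ : p ∈ Q.toIdeal := by
    obtain ⟨c, hc⟩ := hpq.symm.dvd
    rw [hc]
    exact Ideal.mul_mem_right _ _ hqQ
  by_contra h0
  have h1 := (mem_iff_homogeneousComponent_mem Q.isHomogeneous p).1 hpQ 0
  rw [homogeneousComponent_zero] at h1
  refine hP.ne_top (Ideal.eq_top_of_isUnit_mem _ (hQle h1) (IsUnit.map C ?_))
  exact isUnit_iff_ne_zero.2 h0

/-- The entries of a minimal homogeneous generator have no common prime factor `p`: otherwise
dividing by `p` gives a syzygy which expresses the generator through the other ones. -/
theorem IsMinimalHomogeneousGenerators.exists_not_dvd {m : ℕ} {σ : Fin m → Syz f} {a : Fin m → ℤ}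
    (h : IsMinimalHomogeneousGenerators f σ a) (i : Fin m) (p : Ring3 k) (hp : Prime p) :
    ∃ j, ¬ p ∣ (σ i : Fin 3 → Ring3 k) j := by
  classical
  by_contra! hall
  choose v hv using hall
  have hv' : (σ i : Fin 3 → Ring3 k) = p • v := funext hv
  have hvS : v ∈ Syz f := mem_Syz_of_smul_mem hp.ne_zero (hv' ▸ (σ i).2)
  obtain ⟨c, hc⟩ := h.surjective ⟨v, hvS⟩
  -- The relation `p • c - e_i` has coefficient `p * c i - 1` at `i`, which must lie in `𝔪`.
  have hrel : Fintype.linearCombination (Ring3 k) σ (p • c - Pi.single i 1) = 0 := by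
    rw [map_sub, map_smul, hc, Fintype.linearCombination_apply_single, one_smul, sub_eq_zero]
    exact Subtype.ext hv'.symm
  have h1 := h.constantCoeff_eq_zero hrel i
  have hne : (σ i : Fin 3 → Ring3 k) ≠ 0 := fun h0 => h.ne_zero i (Subtype.ext h0)
  obtain ⟨j, hj⟩ := Function.ne_iff.1 hne
  have h2 := constantCoeff_eq_zero_of_prime_dvd hp hj (mem_syzGrading_iff.1 (h.homogeneous i) j)
    ⟨v j, hv j⟩
  simp [h2] at h1

end SyzygyGenerators

/-! ### The cross product and the Bourbaki ideal -/

section Bourbaki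

variable {k : Type*} [Field k] {f : Ring3 k}

/-- `ε × g` is orthogonal to two syzygies, hence proportional to the gradient, for which no
denominators are needed. -/
theorem exists_cross_eq_smul_grad (h0 : grad f ≠ 0)
    (hgcd : ∀ p, Prime p → ∃ i, ¬ p ∣ grad f i) (ε g : Syz f) :
    ∃ r : Ring3 k, crossProduct ε.1 g.1 = r • grad f := by
  refine exists_eq_smul_of_proportional h0 hgcd fun i j => ?_
  have h1 := sum_syz_mul_grad ε
  have h2 := sum_syz_mul_grad g
  rw [cross_apply]
  fin_cases i <;> fin_cases j <;>
    simp only [Fin.zero_eta, Fin.mk_one, Fin.reduceFinMk, Matrix.cons_val_zero,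
      Matrix.cons_val_one, Matrix.cons_val]
  · linear_combination -(g.1 2) * h1 + ε.1 2 * h2
  · linear_combination g.1 1 * h1 - ε.1 1 * h2
  · linear_combination g.1 2 * h1 - ε.1 2 * h2
  · linear_combination -(g.1 0) * h1 + ε.1 0 * h2
  · linear_combination -(g.1 1) * h1 + ε.1 1 * h2
  · linear_combination g.1 0 * h1 - ε.1 0 * h2

/-- There is a linear form `h` on the syzygy module with `ε × g = h(g) ∇f`. -/
theorem exists_bourbakiMap (h0 : grad f ≠ 0)
    (hgcd : ∀ p, Prime p → ∃ i, ¬ p ∣ grad f i) (ε : Syz f) :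
    ∃ h : Syz f →ₗ[Ring3 k] Ring3 k, ∀ g : Syz f, crossProduct ε.1 g.1 = h g • grad f := by
  choose r hr using exists_cross_eq_smul_grad h0 hgcd ε
  have hcancel : ∀ {x y : Ring3 k}, x • grad f = y • grad f → x = y := fun hxy =>
    smul_left_injective _ h0 hxy
  exact ⟨{ toFun := r
           map_add' := fun x y => hcancel (by
             rw [← hr, add_smul, ← hr, ← hr, ← map_add]; rfl)
           map_smul' := fun c x => hcancel (by
             rw [← hr, RingHom.id_apply, smul_assoc, ← hr, ← map_smul]; rfl) }, hr⟩

variable {ε : Syz f} {h : Syz f →ₗ[Ring3 k] Ring3 k}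

/-- The kernel of the Bourbaki map is generated by `ε`. -/
theorem ker_bourbakiMap (h0 : grad f ≠ 0) (hε0 : ε ≠ 0)
    (hεgcd : ∀ p, Prime p → ∃ i, ¬ p ∣ ε.1 i)
    (hh : ∀ g : Syz f, crossProduct ε.1 g.1 = h g • grad f) :
    LinearMap.ker h = Submodule.span (Ring3 k) {ε} := by
  have hcancel : ∀ {x : Ring3 k}, x • grad f = 0 → x = 0 := fun hx =>
    (smul_eq_zero.1 hx).resolve_right h0
  ext g
  rw [LinearMap.mem_ker, Submodule.mem_span_singleton]
  constructor
  · intro hg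
    have h1 := hh g
    rw [hg, zero_smul, cross_apply] at h1
    have e0 := congrFun h1 0
    have e1 := congrFun h1 1
    have e2 := congrFun h1 2
    simp only [Matrix.cons_val_zero, Matrix.cons_val_one, Matrix.cons_val, Pi.zero_apply]
      at e0 e1 e2
    obtain ⟨r, hr⟩ := exists_eq_smul_of_proportional (v := ε.1) (w := g.1)
      (fun hε => hε0 (Subtype.ext hε)) hεgcd fun i j => by
        fin_cases i <;> fin_cases j <;>
          simp only [Fin.zero_eta, Fin.mk_one, Fin.reduceFinMk]
        · linear_combination e2
        · linear_combination -e1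
        · linear_combination -e2
        · linear_combination e0
        · linear_combination e1
        · linear_combination -e0
    exact ⟨r, Subtype.ext hr.symm⟩
  · rintro ⟨r, rfl⟩
    apply hcancel
    rw [← hh]
    change crossProduct ε.1 (r • ε.1) = 0
    rw [map_smul, cross_self, smul_zero]

/-- The image of the Bourbaki map contains the entries of `ε`: they are the values at the Koszul
syzygies `∇f × v`. -/
theorem entry_mem_range_bourbakiMap (h0 : grad f ≠ 0)
    (hh : ∀ g : Syz f, crossProduct ε.1 g.1 = h g • grad f) (i : Fin 3) :
    ε.1 i ∈ LinearMap.range h := by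
  let w : Fin 3 → Ring3 k := crossProduct (grad f) (Pi.single i 1)
  have hw : w ∈ Syz f := by
    rw [mem_Syz]
    change w ⬝ᵥ grad f = 0
    rw [dotProduct_comm]
    exact dot_self_cross _ _
  refine ⟨⟨w, hw⟩, ?_⟩
  refine smul_left_injective _ h0 ?_
  change h ⟨w, hw⟩ • grad f = ε.1 i • grad f
  rw [← hh]
  have h1 := sum_syz_mul_grad ε
  change crossProduct ε.1 w = _
  funext j
  simp only [w, cross_apply]
  fin_cases i <;> fin_cases j <;>
    simp [-mul_eq_zero] <;> linear_combination -h1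

theorem comp_bourbakiMap {d e : ℤ} (h0 : grad f ≠ 0) (hgrad : ∀ i, grad f i ∈ ringGrading k d)
    (hε : ε ∈ syzGrading f e) (hh : ∀ g : Syz f, crossProduct ε.1 g.1 = h g • grad f)
    (g : Syz f) (n : ℤ) : comp n (h g) = h (syzComp hgrad (n + d - e) g) := by
  refine smul_left_injective _ h0 ?_
  change comp n (h g) • grad f = h (syzComp hgrad (n + d - e) g) • grad f
  rw [← hh]
  have h1 : comp n (h g) • grad f = vcomp (fun _ => 0) (n + d) (h g • grad f) := by
    rw [vcomp_smul (b := d) _ (mem_freeGrading.2 fun i => by rw [sub_zero]; exact hgrad i),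
      add_sub_cancel_right]
  rw [h1, ← hh]
  have hε' := mem_syzGrading_iff.1 hε
  have key : ∀ i j, comp (n + d) (ε.1 i * g.1 j) = ε.1 i * comp (n + d - e) (g.1 j) :=
    fun i j => by rw [mul_comm, comp_mul _ (hε' i), mul_comm]
  have hcoe : ∀ j, (syzComp hgrad (n + d - e) g).1 j = comp (n + d - e) (g.1 j) := fun j => by
    change comp (n + d - e - 0) (g.1 j) = _
    rw [sub_zero]
  funext j
  simp only [vcomp_apply, cross_apply, sub_zero, hcoe]
  fin_cases j <;> simp [key]

/-- The isomorphism from `M_ε` onto the image of the Bourbaki map. -/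
noncomputable def bourbakiEquiv (h : Syz f →ₗ[Ring3 k] Ring3 k)
    (hker : LinearMap.ker h = Submodule.span (Ring3 k) {ε}) :
    SyzCoker f ε ≃ₗ[Ring3 k] (LinearMap.range h : Ideal (Ring3 k)) :=
  (Submodule.quotEquivOfEq _ _ hker.symm).trans h.quotKerEquivRange

theorem isGradedIso_bourbakiEquiv {d e : ℤ} (h0 : grad f ≠ 0)
    (hgrad : ∀ i, grad f i ∈ ringGrading k d)
    (hε : ε ∈ syzGrading f e) (hh : ∀ g : Syz f, crossProduct ε.1 g.1 = h g • grad f)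
    (hker : LinearMap.ker h = Submodule.span (Ring3 k) {ε}) :
    IsGradedIso (quotGrading (syzGrading f) (Submodule.span (Ring3 k) {ε}))
      (shift (subGrading (ringGrading k) (LinearMap.range h : Ideal (Ring3 k))) (e - d))
      (bourbakiEquiv h hker) := by
  have hn : ∀ n : ℤ, n + (e - d) + d - e = n := fun n => by ring
  intro n x
  constructor
  · rintro ⟨g, hg, rfl⟩
    change h g ∈ ringGrading k (n + (e - d))
    rw [← comp_eq_self_iff, comp_bourbakiMap h0 hgrad hε hh, hn, syzComp_eq_self hgrad hg]
  · obtain ⟨g, rfl⟩ := Submodule.Quotient.mk_surjective _ x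
    intro hg
    change h g ∈ ringGrading k (n + (e - d)) at hg
    rw [← comp_eq_self_iff, comp_bourbakiMap h0 hgrad hε hh, hn] at hg
    refine ⟨syzComp hgrad n g, syzComp_mem hgrad n g, (Submodule.Quotient.eq _).2 ?_⟩
    rw [← hker, LinearMap.mem_ker, map_sub, hg, sub_self]

theorem isHomogeneous_range_bourbakiMap {d e : ℤ} (h0 : grad f ≠ 0)
    (hgrad : ∀ i, grad f i ∈ ringGrading k d)
    (hε : ε ∈ syzGrading f e) (hh : ∀ g : Syz f, crossProduct ε.1 g.1 = h g • grad f) :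
    (LinearMap.range h : Ideal (Ring3 k)).IsHomogeneous (homogeneousSubmodule (Fin 3) k) := by
  rintro i _ ⟨g, rfl⟩
  refine ⟨syzComp hgrad (i + d - e) g, ?_⟩
  rw [← comp_bourbakiMap h0 hgrad hε hh, comp, if_pos (Int.natCast_nonneg i), Int.toNat_natCast]
  exact (decomposition.decompose'_apply (h g) i).symm

end Bourbaki

/-! ### Saturation of the Bourbaki ideals -/

section Saturation

variable {k : Type*} [Field k] {f : Ring3 k} {ε : Syz f}

/-- If `r₁, r₂, r₃` is a regular sequence and `r₁ c, r₂ c, r₃ c` lie in an ideal isomorphic to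
`M_ε`, so does `c`. The lifts of the `rᵢ c` to syzygies differ by a Koszul cocycle with values in
`R ε`, which is a coboundary; corrected lifts are divisible, and the quotient is a lift of `c`. -/
theorem mem_of_regularTriple_mul_mem (hε0 : ε ≠ 0) {I : Ideal (Ring3 k)}
    (θ : SyzCoker f ε ≃ₗ[Ring3 k] I) {r₁ r₂ r₃ c : Ring3 k} (hr : IsRegularTriple r₁ r₂ r₃)
    (h₁ : r₁ * c ∈ I) (h₂ : r₂ * c ∈ I) (h₃ : r₃ * c ∈ I) : c ∈ I := by
  let u : Syz f →ₗ[Ring3 k] Ring3 k :=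
    I.subtype ∘ₗ θ.toLinearMap ∘ₗ (Submodule.span (Ring3 k) {ε}).mkQ
  have hu : ∀ x ∈ I, ∃ g, u g = x := fun x hx => by
    obtain ⟨g, hg⟩ := Submodule.Quotient.mk_surjective _ (θ.symm ⟨x, hx⟩)
    refine ⟨g, ?_⟩
    change ((θ (Submodule.Quotient.mk g) : I) : Ring3 k) = x
    rw [hg, LinearEquiv.apply_symm_apply]
  have hu0 : ∀ g, u g = 0 → ∃ s : Ring3 k, s • ε = g := fun g hg => by
    have h1 : θ (Submodule.Quotient.mk g) = 0 := Subtype.ext hg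
    rw [LinearEquiv.map_eq_zero_iff, Submodule.Quotient.mk_eq_zero] at h1
    exact Submodule.mem_span_singleton.1 h1
  have huε : u ε = 0 := by
    change ((θ (Submodule.Quotient.mk ε) : I) : Ring3 k) = 0
    rw [(Submodule.Quotient.mk_eq_zero _).2 (Submodule.mem_span_singleton_self ε), map_zero]
    rfl
  obtain ⟨g₁, hg₁⟩ := hu _ h₁
  obtain ⟨g₂, hg₂⟩ := hu _ h₂
  obtain ⟨g₃, hg₃⟩ := hu _ h₃
  obtain ⟨s₁₂, hs₁₂⟩ := hu0 (r₂ • g₁ - r₁ • g₂) (by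
    rw [map_sub, map_smul, map_smul, hg₁, hg₂, smul_eq_mul, smul_eq_mul]; ring)
  obtain ⟨s₁₃, hs₁₃⟩ := hu0 (r₃ • g₁ - r₁ • g₃) (by
    rw [map_sub, map_smul, map_smul, hg₁, hg₃, smul_eq_mul, smul_eq_mul]; ring)
  obtain ⟨s₂₃, hs₂₃⟩ := hu0 (r₃ • g₂ - r₂ • g₃) (by
    rw [map_sub, map_smul, map_smul, hg₂, hg₃, smul_eq_mul, smul_eq_mul]; ring)
  have hcyc : r₁ * s₂₃ + r₂ * (-s₁₃) + r₃ * s₁₂ = 0 := by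
    have : (r₁ * s₂₃ + r₂ * (-s₁₃) + r₃ * s₁₂) • ε = 0 := by
      rw [add_smul, add_smul, mul_smul, mul_smul, mul_smul, neg_smul, hs₂₃, hs₁₃, hs₁₂]
      module
    exact (smul_eq_zero.1 this).resolve_right hε0
  obtain ⟨p, q, s, -, -, h12⟩ := hr.koszul hcyc
  obtain ⟨G, hG⟩ : ∃ G : Fin 3 → Ring3 k, (g₁ + s • ε).1 = r₁ • G := by
    have hdvd : ∀ j, r₁ ∣ (g₁ + s • ε).1 j := fun j => hr.dvd _ ⟨(g₂ - q • ε).1 j, by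
      have hj := congrArg (fun g : Syz f => g.1 j) hs₁₂
      simp only [Submodule.coe_smul, Submodule.coe_sub, Submodule.coe_add, Pi.smul_apply,
        Pi.sub_apply, Pi.add_apply, smul_eq_mul] at hj ⊢
      rw [h12] at hj
      linear_combination -hj⟩
    choose G hG using hdvd
    exact ⟨G, funext hG⟩
  have hGS : G ∈ Syz f := mem_Syz_of_smul_mem hr.ne_zero (hG ▸ (g₁ + s • ε).2)
  have hG' : g₁ + s • ε = r₁ • (⟨G, hGS⟩ : Syz f) := Subtype.ext hG
  have huG : r₁ * u ⟨G, hGS⟩ = r₁ * c := by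
    have := congrArg u hG'
    rw [map_add, map_smul, map_smul, huε, smul_zero, add_zero, hg₁, smul_eq_mul] at this
    exact this.symm
  rw [← mul_left_cancel₀ hr.ne_zero huG]
  exact (θ _).2

theorem mem_of_X_mul_mem (hε0 : ε ≠ 0) {I : Ideal (Ring3 k)}
    (θ : SyzCoker f ε ≃ₗ[Ring3 k] I) {c : Ring3 k} (h : ∀ i, X i * c ∈ I) : c ∈ I :=
  mem_of_regularTriple_mul_mem hε0 θ isRegularTriple_X (h 0) (h 1) (h 2)

/-- The associated primes of `R ⧸ I` do not contain all the variables. -/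
theorem exists_X_notMem_of_mem_associatedPrimes (hε0 : ε ≠ 0) {I : Ideal (Ring3 k)}
    (θ : SyzCoker f ε ≃ₗ[Ring3 k] I) {P : Ideal (Ring3 k)}
    (hP : P ∈ associatedPrimes (Ring3 k) (Ring3 k ⧸ I)) : ∃ i, X i ∉ P := by
  by_contra! hall
  obtain ⟨hPp, x, hx⟩ := isAssociatedPrime_iff.1 hP
  obtain ⟨c, rfl⟩ := Ideal.Quotient.mk_surjective x
  have hmem : ∀ r, r ∈ P ↔ r * c ∈ I := fun r => by
    rw [hx, Submodule.mem_colon_singleton, Submodule.mem_bot, ← Ideal.Quotient.eq_zero_iff_mem,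
      map_mul]
    rfl
  have hc := mem_of_X_mul_mem hε0 θ (c := c) fun i => (hmem _).1 (hall i)
  exact hPp.ne_top ((Ideal.eq_top_iff_one P).2 ((hmem 1).2 (by rwa [one_mul])))

theorem exists_mem_associatedPrimes {I : Ideal (Ring3 k)} (hI : I ≠ ⊤) :
    ∃ P ∈ associatedPrimes (Ring3 k) (Ring3 k ⧸ I), I ≤ P := by
  have : Nontrivial (Ring3 k ⧸ I) := Ideal.Quotient.nontrivial_iff.2 hI
  obtain ⟨P, hP⟩ := associatedPrimes.nonempty (Ring3 k) (Ring3 k ⧸ I)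
  refine ⟨P, hP, ?_⟩
  have := IsAssociatedPrime.annihilator_le hP
  rwa [Submodule.annihilator_top, Ideal.annihilator_quotient] at this

/-- A proper homogeneous ideal isomorphic to `M_ε` has height at most two: the only homogeneous
prime ideal of height three is the irrelevant ideal, and it is not associated. -/
theorem height_le_two (hε0 : ε ≠ 0) {I : Ideal (Ring3 k)} (hI : I ≠ ⊤)
    (hhom : I.IsHomogeneous (homogeneousSubmodule (Fin 3) k))
    (θ : SyzCoker f ε ≃ₗ[Ring3 k] I) : I.height ≤ 2 := by
  obtain ⟨P, hP, hIP⟩ := exists_mem_associatedPrimes hI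
  have hPp : P.IsPrime := hP.isPrime
  let Q := (Ideal.homogeneousCore (homogeneousSubmodule (Fin 3) k) P)
  have hQ : Q.toIdeal.IsPrime := hPp.homogeneousCore
  have hQP : Q.toIdeal ≤ P := Ideal.toIdeal_homogeneousCore_le _ _
  have hIQ : I ≤ Q.toIdeal := by
    rw [← hhom.toIdeal_homogeneousCore_eq_self]
    exact Ideal.homogeneousCore_mono _ hIP
  refine (Ideal.height_mono hIQ).trans ?_
  have hm : (RingHom.ker (constantCoeff : Ring3 k →+* k)).IsPrime := RingHom.ker_isPrime _
  have hlt : Q.toIdeal < RingHom.ker (constantCoeff : Ring3 k →+* k) := by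
    refine lt_of_le_of_ne (fun q hq => ?_) fun h => ?_
    · by_contra hq0
      have h1 := (mem_iff_homogeneousComponent_mem Q.isHomogeneous q).1 hq 0
      rw [homogeneousComponent_zero] at h1
      exact hQ.ne_top (Ideal.eq_top_of_isUnit_mem _ h1 (IsUnit.map C (isUnit_iff_ne_zero.2 hq0)))
    · obtain ⟨i, hi⟩ := exists_X_notMem_of_mem_associatedPrimes hε0 θ hP
      refine hi (hQP ?_)
      rw [h, RingHom.mem_ker, constantCoeff_X]
  have h1 := Ideal.height_add_one_le_of_lt_of_isPrime hlt
  have h2 : (RingHom.ker (constantCoeff : Ring3 k →+* k)).height ≤ 3 := by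
    have h3 := Ideal.height_le_ringKrullDim_of_ne_top hm.ne_top
    rw [ringKrullDim_of_isNoetherianRing, ringKrullDim_eq_zero_of_field, Nat.card_fin, zero_add]
      at h3
    exact WithBot.coe_le_coe.1 h3
  have h3 : Q.toIdeal.height + 1 ≤ 2 + 1 := h1.trans (h2.trans (by norm_num))
  exact (ENat.add_le_add_iff_right (by norm_num)).1 h3

end Saturation

/-! ### Free divisors and projective syzygy modules -/

section FreeDivisor

variable {k : Type*} [Field k] {f : Ring3 k}

theorem derivation_apply_eq_sum (δ : Derivation k (Ring3 k) (Ring3 k)) (p : Ring3 k) :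
    δ p = ∑ i, δ (X i) * grad p i := by
  have hsum : ∀ q, (∑ i, δ (X i) • (pderiv i : Derivation k (Ring3 k) (Ring3 k))) q =
      ∑ i, (δ (X i) • (pderiv i : Derivation k (Ring3 k) (Ring3 k))) q := fun q => by
    simp only [Fin.sum_univ_three, Derivation.add_apply]
  have h : δ = ∑ i, δ (X i) • (pderiv i : Derivation k (Ring3 k) (Ring3 k)) := by
    refine derivation_ext fun j => ?_
    rw [hsum, Finset.sum_eq_single j]
    · simp
    · intro i _ hij
      rw [Derivation.smul_apply, pderiv_X_of_ne hij.symm, smul_zero]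
    · simp
  conv_lhs => rw [h, hsum]
  rfl

/-- The logarithmic derivation `r E + g₀ ∂_x + g₁ ∂_y + g₂ ∂_z`, where `E` is the Euler
derivation. -/
noncomputable def toLogDer {n : ℕ} (hf : f.IsHomogeneous n) :
    (Ring3 k × Syz f) →ₗ[Ring3 k] logDer f where
  toFun q := ⟨mkDerivation k (q.1 • X + q.2.1), by
    change mkDerivation k (q.1 • X + q.2.1) f ∈ Ideal.span {f}
    rw [derivation_apply_eq_sum, Ideal.mem_span_singleton]
    have h1 := mem_Syz.1 q.2.2
    have h2 := sum_X_mul_grad hf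
    refine ⟨q.1 * n, ?_⟩
    simp only [mkDerivation_X, Pi.add_apply, Pi.smul_apply, smul_eq_mul, add_mul,
      Finset.sum_add_distrib, h1, add_zero, mul_assoc, ← Finset.mul_sum, h2]
    ring⟩
  map_add' q q' := Subtype.ext (derivation_ext fun i => by
    simp [mkDerivation_X, add_mul]; ring)
  map_smul' c q := Subtype.ext (derivation_ext fun i => by
    simp [mkDerivation_X, mul_add, mul_assoc])

theorem toLogDer_apply_X {n : ℕ} (hf : f.IsHomogeneous n) (q : Ring3 k × Syz f) (i : Fin 3) :
    (toLogDer hf q).1 (X i) = q.1 * X i + q.2.1 i :=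
  mkDerivation_X k _ i

/-- If the degree of `f` is invertible in `k`, the logarithmic derivations of `f` are the sum of the
multiples of the Euler derivation and of the syzygies of the gradient. -/
theorem bijective_toLogDer {n : ℕ} (hn : (n : k) ≠ 0) (hf0 : f ≠ 0) (hf : f.IsHomogeneous n) :
    Function.Bijective (toLogDer hf) := by
  have hnu : (C ((n : k)⁻¹) : Ring3 k) * n = 1 := by
    rw [← map_natCast (C : k →+* Ring3 k), ← C_mul, inv_mul_cancel₀ hn, C_1]
  have hn0 : (n : Ring3 k) ≠ 0 := right_ne_zero_of_mul_eq_one hnu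
  constructor
  · rw [injective_iff_map_eq_zero]
    intro q hq
    have hX : ∀ i, q.1 * X i + q.2.1 i = 0 := fun i => by
      rw [← toLogDer_apply_X hf, hq]; rfl
    have h1 : q.1 * ((n : Ring3 k) * f) = 0 := by
      rw [← sum_X_mul_grad hf, Finset.mul_sum]
      have h2 := mem_Syz.1 q.2.2
      have h3 : ∑ i, q.1 * (X i * grad f i) + ∑ i, q.2.1 i * grad f i = 0 := by
        rw [← Finset.sum_add_distrib]
        refine Finset.sum_eq_zero fun i _ => ?_
        rw [← mul_assoc, ← add_mul, hX, zero_mul]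
      rwa [h2, add_zero] at h3
    have h3 : q.1 = 0 := (mul_eq_zero.1 h1).resolve_right (mul_ne_zero hn0 hf0)
    refine Prod.ext h3 (Subtype.ext (funext fun i => ?_))
    have := hX i
    rwa [h3, zero_mul, zero_add] at this
  · rintro ⟨δ, hδ⟩
    obtain ⟨c, hc⟩ := Ideal.mem_span_singleton.1 (show δ f ∈ Ideal.span {f} from hδ)
    let r : Ring3 k := c * C ((n : k)⁻¹)
    have hg : (fun i => δ (X i) - r * X i) ∈ Syz f := by
      rw [mem_Syz]
      simp only [sub_mul, Finset.sum_sub_distrib, mul_assoc, ← Finset.mul_sum]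
      rw [← derivation_apply_eq_sum, hc, sum_X_mul_grad hf]
      linear_combination (-(c * f)) * hnu
    refine ⟨(r, ⟨_, hg⟩), Subtype.ext (derivation_ext fun i => ?_)⟩
    rw [toLogDer_apply_X]
    ring

theorem projective_Syz_of_isFreeDivisor {n : ℕ} (hn : (n : k) ≠ 0) (hf0 : f ≠ 0)
    (hf : f.IsHomogeneous n) (h : IsFreeDivisor f) : Module.Projective (Ring3 k) (Syz f) := by
  have hfree : Module.Free (Ring3 k) (logDer f) := h
  have hp : Module.Projective (Ring3 k) (Ring3 k × Syz f) :=
    Module.Projective.of_equiv (LinearEquiv.ofBijective _ (bijective_toLogDer hn hf0 hf)).symm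
  exact Module.Projective.of_split (LinearMap.inr (Ring3 k) (Ring3 k) (Syz f))
    (LinearMap.snd (Ring3 k) (Ring3 k) (Syz f)) (LinearMap.snd_comp_inr _ _ _)

theorem isFreeDivisor_of_free_Syz {n : ℕ} (hn : (n : k) ≠ 0) (hf0 : f ≠ 0)
    (hf : f.IsHomogeneous n) (h : Module.Free (Ring3 k) (Syz f)) : IsFreeDivisor f :=
  Module.Free.of_equiv (LinearEquiv.ofBijective _ (bijective_toLogDer hn hf0 hf))

end FreeDivisor

/-! ### The presentation of `M_ε` by the remaining generators -/

section Tail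

variable {k : Type*} [Field k] {f : Ring3 k} {m : ℕ} {σ : Fin (m + 1) → Syz f}
  {a : Fin (m + 1) → ℤ}

theorem linearCombination_eq_add_tail (σ : Fin (m + 1) → Syz f) (w : Fin (m + 1) → Ring3 k) :
    Fintype.linearCombination (Ring3 k) σ w =
      w 0 • σ 0 + Fintype.linearCombination (Ring3 k) (fun i : Fin m => σ i.succ)
        fun i => w i.succ := by
  simp only [Fintype.linearCombination_apply, Fin.sum_univ_succ]

/-- The map `⨁ R → M_ε` given by the generators other than `ε = σ 0`. -/
noncomputable def tailMap (σ : Fin (m + 1) → Syz f) :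
    (Fin m → Ring3 k) →ₗ[Ring3 k] SyzCoker f (σ 0) :=
  (Submodule.span (Ring3 k) {σ 0}).mkQ ∘ₗ
    Fintype.linearCombination (Ring3 k) fun i : Fin m => σ i.succ

theorem tailMap_eq_zero_iff {v : Fin m → Ring3 k} :
    tailMap σ v = 0 ↔ ∃ c : Ring3 k, Fintype.linearCombination (Ring3 k) σ (Fin.cons c v) = 0 := by
  rw [tailMap, LinearMap.comp_apply, Submodule.mkQ_apply, Submodule.Quotient.mk_eq_zero,
    Submodule.mem_span_singleton]
  simp only [linearCombination_eq_add_tail, Fin.cons_zero, Fin.cons_succ]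
  constructor
  · rintro ⟨c, hc⟩
    exact ⟨-c, by rw [← hc]; module⟩
  · rintro ⟨c, hc⟩
    exact ⟨-c, by rw [neg_smul]; exact neg_eq_of_add_eq_zero_right hc⟩

namespace IsMinimalHomogeneousGenerators

theorem surjective_tailMap (h : IsMinimalHomogeneousGenerators f σ a) :
    Function.Surjective (tailMap σ) := by
  intro x
  obtain ⟨g, rfl⟩ := Submodule.Quotient.mk_surjective _ x
  obtain ⟨w, rfl⟩ := h.surjective g
  refine ⟨fun i => w i.succ, (Submodule.Quotient.eq _).2 ?_⟩
  rw [linearCombination_eq_add_tail, sub_add_cancel_right]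
  exact Submodule.neg_mem _ (Submodule.smul_mem _ _ (Submodule.mem_span_singleton_self _))

theorem injective_of_projective_Syz (h : IsMinimalHomogeneousGenerators f σ a)
    (hp : Module.Projective (Ring3 k) (Syz f)) :
    Function.Injective (Fintype.linearCombination (Ring3 k) σ) :=
  injective_of_projective _ h.surjective fun _ hv j => h.constantCoeff_eq_zero hv j

theorem injective_of_projective_SyzCoker (h : IsMinimalHomogeneousGenerators f σ a)
    (hp : Module.Projective (Ring3 k) (SyzCoker f (σ 0))) :
    Function.Injective (tailMap σ) :=
  injective_of_projective _ h.surjective_tailMap fun v hv j => by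
    obtain ⟨c, hc⟩ := tailMap_eq_zero_iff.1 hv
    simpa using h.constantCoeff_eq_zero hc j.succ

theorem injective_tailMap_iff (h : IsMinimalHomogeneousGenerators f σ a) :
    Function.Injective (tailMap σ) ↔
      Function.Injective (Fintype.linearCombination (Ring3 k) σ) := by
  rw [injective_iff_map_eq_zero, injective_iff_map_eq_zero]
  constructor
  · intro hinj w hw
    have hw' : Fin.cons (w 0) (fun i : Fin m => w i.succ) = w := Fin.cons_self_tail w
    have h1 := hinj (fun i => w i.succ) (tailMap_eq_zero_iff.2 ⟨w 0, by rw [hw', hw]⟩)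
    rw [linearCombination_eq_add_tail, h1, map_zero, add_zero] at hw
    have h2 := (smul_eq_zero.1 hw).resolve_right (h.ne_zero 0)
    rw [← hw', h1, h2]
    funext i
    refine Fin.cases rfl (fun _ => rfl) i
  · intro hinj v hv
    obtain ⟨c, hc⟩ := tailMap_eq_zero_iff.1 hv
    have := hinj _ hc
    funext i
    simpa using congrFun this i.succ

/-- Both conditions say that the minimal generators `σ` are linearly independent. -/
theorem free_SyzCoker_iff (h : IsMinimalHomogeneousGenerators f σ a) {n : ℕ} (hn : (n : k) ≠ 0)
    (hf0 : f ≠ 0) (hf : f.IsHomogeneous n) :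
    Module.Free (Ring3 k) (SyzCoker f (σ 0)) ↔ IsFreeDivisor f := by
  constructor
  · intro hM
    have h1 := h.injective_tailMap_iff.1
      (h.injective_of_projective_SyzCoker inferInstance)
    exact isFreeDivisor_of_free_Syz hn hf0 hf
      (Module.Free.of_equiv (LinearEquiv.ofBijective _ ⟨h1, h.surjective⟩))
  · intro hfree
    have h1 := h.injective_tailMap_iff.2
      (h.injective_of_projective_Syz (projective_Syz_of_isFreeDivisor hn hf0 hf hfree))
    exact Module.Free.of_equiv (LinearEquiv.ofBijective _ ⟨h1, h.surjective_tailMap⟩)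

theorem free_of_projective_SyzCoker (h : IsMinimalHomogeneousGenerators f σ a)
    (hp : Module.Projective (Ring3 k) (SyzCoker f (σ 0))) :
    Module.Free (Ring3 k) (SyzCoker f (σ 0)) :=
  Module.Free.of_equiv (LinearEquiv.ofBijective _
    ⟨h.injective_of_projective_SyzCoker hp, h.surjective_tailMap⟩)

end IsMinimalHomogeneousGenerators

end Tail

/-! ### The graded resolution of the syzygy module -/

section Resolution

variable {k : Type*} [Field k] {f : Ring3 k}

theorem exists_koszul_vec {ι : Type*} {a b c : ι → Ring3 k}
    (h : (X 0 : Ring3 k) • a + (X 1 : Ring3 k) • b + (X 2 : Ring3 k) • c = 0) :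
    ∃ p q s : ι → Ring3 k, a = (X 1 : Ring3 k) • p + (X 2 : Ring3 k) • q ∧
      b = -((X 0 : Ring3 k) • p) + (X 2 : Ring3 k) • s ∧
      c = -((X 0 : Ring3 k) • q) - (X 1 : Ring3 k) • s := by
  have h' : ∀ i, X 0 * a i + X 1 * b i + X 2 * c i = 0 := fun i => congrFun h i
  choose p q s h1 h2 h3 using fun i => isRegularTriple_X.koszul (h' i)
  exact ⟨p, q, s, funext h1, funext h2, funext h3⟩

/-- The Koszul homology `H₂(x, y, z; Syz)` vanishes. -/
theorem exists_koszul_syz {p q s : Syz f}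
    (h1 : (X 1 : Ring3 k) • p + (X 2 : Ring3 k) • q = 0)
    (h2 : (X 2 : Ring3 k) • s = (X 0 : Ring3 k) • p) :
    ∃ t : Syz f, p = (X 2 : Ring3 k) • t ∧ q = -((X 1 : Ring3 k) • t) ∧
      s = (X 0 : Ring3 k) • t := by
  have hX : ∀ i : Fin 3, (X i : Ring3 k) ≠ 0 := fun i => X_ne_zero i
  have hdvd : ∀ j, (X 0 : Ring3 k) ∣ s.1 j := fun j => by
    have hj : (X 0 : Ring3 k) ∣ X 2 * s.1 j := ⟨p.1 j, congrArg (fun g : Syz f => g.1 j) h2⟩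
    refine ((X_prime (i := (0 : Fin 3))).dvd_or_dvd hj).resolve_left ?_
    rw [X_dvd_X]
    simp
  choose t ht using hdvd
  have hs : s.1 = (X 0 : Ring3 k) • t := funext ht
  let T : Syz f := ⟨t, mem_Syz_of_smul_mem (hX 0) (hs ▸ s.2)⟩
  have hsT : s = (X 0 : Ring3 k) • T := Subtype.ext hs
  have hpT : p = (X 2 : Ring3 k) • T := by
    refine smul_right_injective _ (hX 0) ?_
    change (X 0 : Ring3 k) • p = (X 0 : Ring3 k) • (X 2 : Ring3 k) • T
    rw [← h2, hsT, smul_comm]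
  refine ⟨T, hpT, ?_, hsT⟩
  refine smul_right_injective _ (hX 2) ?_
  change (X 2 : Ring3 k) • q = (X 2 : Ring3 k) • -((X 1 : Ring3 k) • T)
  rw [smul_neg, smul_comm, ← hpT]
  exact eq_neg_of_add_eq_zero_right h1

/-- Minimal generators of the relation module of the syzygies are linearly independent: if `K₂`
denotes the module of their relations, the vanishing of Koszul homology gives `K₂ ⊆ 𝔪 K₂`. -/
theorem injective_of_span_eq_ker {m n : ℕ} {φ : (Fin m → Ring3 k) →ₗ[Ring3 k] Syz f}
    (hφ : Function.Surjective φ) {τ : Fin n → Fin m → Ring3 k}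
    (hspan : Submodule.span (Ring3 k) (Set.range τ) = LinearMap.ker φ)
    (hmin : ∀ c, Fintype.linearCombination (Ring3 k) τ c = 0 → ∀ j, constantCoeff (c j) = 0) :
    Function.Injective (Fintype.linearCombination (Ring3 k) τ) := by
  set Ψ := Fintype.linearCombination (Ring3 k) τ with hΨ
  have hrange : LinearMap.range Ψ = LinearMap.ker φ := by
    rw [hΨ, Fintype.range_linearCombination, hspan]
  have hker : ∀ v, φ v = 0 → ∃ c, Ψ c = v := fun v hv => by
    have : v ∈ LinearMap.range Ψ := hrange ▸ LinearMap.mem_ker.2 hv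
    exact this
  have hcomp : ∀ c, φ (Ψ c) = 0 := fun c => by
    have : Ψ c ∈ LinearMap.ker φ := hrange ▸ LinearMap.mem_range_self Ψ c
    exact this
  rw [← LinearMap.ker_eq_bot]
  refine eq_bot_of_le_irrelevant_smul fun u hu => ?_
  have hu0 : Ψ u = 0 := hu
  have hdec : ∀ j, ∃ w : Fin 3 → Ring3 k, ∑ i, w i * X i = u j := fun j =>
    (Ideal.mem_span_range_iff_exists_fun).1 (mem_irrelevant.2 (hmin u hu0 j))
  choose w hw using hdec
  -- Write `u = x a + y b + z c`; Koszul exactness moves `a`, `b`, `c` into the module of relations.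
  let a : Fin n → Ring3 k := fun j => w j 0
  let b : Fin n → Ring3 k := fun j => w j 1
  let c : Fin n → Ring3 k := fun j => w j 2
  have huabc : u = (X 0 : Ring3 k) • a + (X 1 : Ring3 k) • b + (X 2 : Ring3 k) • c := by
    funext j
    rw [← hw j, Fin.sum_univ_three]
    simp only [a, b, c, Pi.add_apply, Pi.smul_apply, smul_eq_mul]
    ring
  have h1 : (X 0 : Ring3 k) • Ψ a + (X 1 : Ring3 k) • Ψ b + (X 2 : Ring3 k) • Ψ c = 0 := by
    rw [← map_smul, ← map_smul, ← map_smul, ← map_add, ← map_add, ← huabc, hu0]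
  obtain ⟨p, q, s, ha, hb, hc⟩ := exists_koszul_vec h1
  obtain ⟨t, hp, hq, hs⟩ := exists_koszul_syz (p := φ p) (q := φ q) (s := φ s)
    (by rw [← map_smul, ← map_smul, ← map_add, ← ha, hcomp])
    (by
      have := hcomp b
      rw [hb, map_add, map_neg, map_smul, map_smul] at this
      exact (neg_add_eq_zero.1 this).symm)
  obtain ⟨T, rfl⟩ := hφ t
  obtain ⟨p', hp'⟩ := hker (p - (X 2 : Ring3 k) • T) (by rw [map_sub, map_smul, hp, sub_self])
  obtain ⟨q', hq'⟩ := hker (q + (X 1 : Ring3 k) • T)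
    (by rw [map_add, map_smul, hq, neg_add_cancel])
  obtain ⟨s', hs'⟩ := hker (s - (X 0 : Ring3 k) • T) (by rw [map_sub, map_smul, hs, sub_self])
  have hX : ∀ (i : Fin 3) v, v ∈ LinearMap.ker Ψ →
      (X i : Ring3 k) • v ∈ irrelevant k • LinearMap.ker Ψ := fun i v hv =>
    Submodule.smul_mem_smul (Ideal.subset_span ⟨i, rfl⟩) hv
  have hsum : u = (X 0 : Ring3 k) • (a - (X 1 : Ring3 k) • p' - (X 2 : Ring3 k) • q') +
      (X 1 : Ring3 k) • (b + (X 0 : Ring3 k) • p' - (X 2 : Ring3 k) • s') +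
      (X 2 : Ring3 k) • (c + (X 0 : Ring3 k) • q' + (X 1 : Ring3 k) • s') := by
    rw [huabc]
    module
  rw [hsum]
  refine Submodule.add_mem _ (Submodule.add_mem _ (hX 0 _ ?_) (hX 1 _ ?_)) (hX 2 _ ?_) <;>
    rw [LinearMap.mem_ker]
  · rw [map_sub, map_sub, map_smul, map_smul, hp', hq', ha]
    module
  · rw [map_sub, map_add, map_smul, map_smul, hp', hs', hb]
    module
  · rw [map_add, map_add, map_smul, map_smul, hq', hs', hc]
    module

theorem isGradedHom_of_forall_single {n : ℕ} {M : Type*} [AddCommGroup M] [Module (Ring3 k) M]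
    {𝓜 : ℤ → AddSubgroup M} {b : Fin n → ℤ}
    (h𝓜 : ∀ (p q : ℤ) (c : Ring3 k) (x : M), c ∈ ringGrading k p → x ∈ 𝓜 q → c • x ∈ 𝓜 (p + q))
    {τ : Fin n → M} (hτ : ∀ j, τ j ∈ 𝓜 (b j)) :
    IsGradedHom (freeGrading k b) 𝓜 (Fintype.linearCombination (Ring3 k) τ) := by
  intro p v hv
  rw [Fintype.linearCombination_apply]
  refine AddSubgroup.sum_mem _ fun j _ => ?_
  have := h𝓜 _ _ _ _ (mem_freeGrading.1 hv j) (hτ j)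
  rwa [sub_add_cancel] at this

theorem smul_mem_freeGrading {ι : Type*} {a : ι → ℤ} {p q : ℤ} {c : Ring3 k} {v : ι → Ring3 k}
    (hc : c ∈ ringGrading k p) (hv : v ∈ freeGrading k a q) : c • v ∈ freeGrading k a (p + q) := by
  rw [mem_freeGrading] at hv ⊢
  intro i
  rw [add_sub_assoc]
  exact mul_mem_ringGrading hc (hv i)

theorem smul_mem_syzGrading {p q : ℤ} {c : Ring3 k} {g : Syz f}
    (hc : c ∈ ringGrading k p) (hg : g ∈ syzGrading f q) : c • g ∈ syzGrading f (p + q) :=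
  mem_syzGrading.2 (smul_mem_freeGrading hc (mem_syzGrading.1 hg))

theorem isGradedHom_linearCombination_syz {n : ℕ} {b : Fin n → ℤ} {τ : Fin n → Syz f}
    (hτ : ∀ j, τ j ∈ syzGrading f (b j)) :
    IsGradedHom (freeGrading k b) (syzGrading f) (Fintype.linearCombination (Ring3 k) τ) := by
  refine isGradedHom_of_forall_single (𝓜 := syzGrading f) ?_ hτ
  intro p q c x hc hx
  exact smul_mem_syzGrading hc hx

/-- A minimal set of homogeneous generators of the syzygy module extends to a minimal graded free
resolution of length one. -/
theorem IsMinimalHomogeneousGenerators.exists_resolution {m : ℕ} {σ : Fin m → Syz f}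
    {a : Fin m → ℤ} (h : IsMinimalHomogeneousGenerators f σ a) :
    ∃ (n : ℕ) (b : Fin n → ℤ) (Ψ : (Fin n → Ring3 k) →ₗ[Ring3 k] (Fin m → Ring3 k)),
      IsMinimalGradedFreeResolution (syzGrading f) a b Ψ
        (Fintype.linearCombination (Ring3 k) σ) := by
  have hkerK : LinearMap.ker (Fintype.linearCombination (Ring3 k) σ) = LinearMap.ker
      (Fintype.linearCombination (Ring3 k) fun i => (σ i : Fin 3 → Ring3 k)) := by
    ext v
    rw [LinearMap.mem_ker, LinearMap.mem_ker, ← coe_linearCombination]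
    exact Submodule.coe_eq_zero.symm
  have hgr : IsGradedSubmodule a (LinearMap.ker (Fintype.linearCombination (Ring3 k) σ)) :=
    hkerK ▸ isGradedSubmodule_ker h.mem_freeGrading
  obtain ⟨n, τ, b, hτ, hspan, hmin⟩ := exists_minimal_generators hgr
  refine ⟨n, b, Fintype.linearCombination (Ring3 k) τ, ?_, ?_, ?_, ?_, h.surjective, ?_⟩
  · refine isGradedHom_of_forall_single (𝓜 := freeGrading k a) ?_ hτ
    intro p q c x hc hx
    exact smul_mem_freeGrading hc hx
  · exact isGradedHom_linearCombination_syz h.homogeneous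
  · exact injective_of_span_eq_ker h.surjective hspan fun c hc j =>
      constantCoeff_eq_zero_of_relation hτ hmin hc j
  · rw [LinearMap.exact_iff, Fintype.range_linearCombination, hspan]
  · rw [Fintype.range_linearCombination, hspan]
    exact fun v hv => mem_irrelevant_smul_top.2 fun j => h.constantCoeff_eq_zero hv j

/-- Deleting the first generator `ε = σ 0` from a resolution of the syzygy module leaves a
resolution of `M_ε`, and hence of any ideal isomorphic to it. -/
theorem IsMinimalGradedFreeResolution.tail {m n : ℕ} {σ : Fin (m + 1) → Syz f}
    {a : Fin (m + 1) → ℤ} {b : Fin n → ℤ}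
    {Ψ : (Fin n → Ring3 k) →ₗ[Ring3 k] (Fin (m + 1) → Ring3 k)}
    (hσ : IsMinimalHomogeneousGenerators f σ a)
    (h : IsMinimalGradedFreeResolution (syzGrading f) a b Ψ
      (Fintype.linearCombination (Ring3 k) σ)) {s : ℤ} {I : Ideal (Ring3 k)}
    (θ : SyzCoker f (σ 0) ≃ₗ[Ring3 k] I)
    (hθ : IsGradedIso (quotGrading (syzGrading f) (Submodule.span (Ring3 k) {σ 0}))
      (shift (subGrading (ringGrading k) I) (-s)) θ) :
    IsMinimalGradedFreeResolution (subGrading (ringGrading k) I)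
      (fun i : Fin m => a i.succ - s) (fun j : Fin n => b j - s)
      (LinearMap.funLeft (Ring3 k) (Ring3 k) Fin.succ ∘ₗ Ψ)
      (θ.toLinearMap ∘ₗ tailMap σ) := by
  have hex : ∀ w, Fintype.linearCombination (Ring3 k) σ w = 0 ↔ w ∈ Set.range Ψ := h.exact
  refine ⟨fun p v hv => ?_, fun p v hv => ?_, ?_, fun v => ?_, ?_, ?_⟩
  · have h1 := h.graded_left (p + s) v (mem_freeGrading.2 fun j => by
      have := mem_freeGrading.1 hv j
      rwa [sub_sub_eq_add_sub] at this)
    refine mem_freeGrading.2 fun i => ?_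
    have := mem_freeGrading.1 h1 i.succ
    rw [sub_sub_eq_add_sub]
    exact this
  · have h1 : Fintype.linearCombination (Ring3 k) (fun i : Fin m => σ i.succ) v ∈
        syzGrading f (p + s) :=
      isGradedHom_linearCombination_syz (b := fun i : Fin m => a i.succ)
        (fun i => hσ.homogeneous i.succ) (p + s) v (mem_freeGrading.2 fun j => by
          have := mem_freeGrading.1 hv j
          rwa [sub_sub_eq_add_sub] at this)
    have h2 := (hθ (p + s) (tailMap σ v)).1 ⟨_, h1, rfl⟩
    rwa [shift, add_neg_cancel_right] at h2
  · rw [injective_iff_map_eq_zero]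
    intro c hc
    have hsucc : ∀ i : Fin m, Ψ c i.succ = 0 := fun i => congrFun hc i
    have h1 := (hex (Ψ c)).2 ⟨c, rfl⟩
    rw [linearCombination_eq_add_tail] at h1
    simp only [hsucc] at h1
    rw [show (fun _ : Fin m => (0 : Ring3 k)) = 0 from rfl, map_zero, add_zero] at h1
    have h2 := (smul_eq_zero.1 h1).resolve_right (hσ.ne_zero 0)
    refine (injective_iff_map_eq_zero Ψ).1 h.injective c (funext fun i => ?_)
    exact Fin.cases h2 hsucc i
  · rw [LinearMap.comp_apply, LinearEquiv.coe_coe, LinearEquiv.map_eq_zero_iff,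
      tailMap_eq_zero_iff]
    constructor
    · rintro ⟨c, hc⟩
      obtain ⟨w, hw⟩ := (hex _).1 hc
      refine ⟨w, funext fun i => ?_⟩
      change Ψ w i.succ = v i
      rw [hw, Fin.cons_succ]
    · rintro ⟨w, rfl⟩
      refine ⟨Ψ w 0, (hex _).2 ⟨w, (Fin.cons_self_tail (Ψ w)).symm⟩⟩
  · exact θ.surjective.comp hσ.surjective_tailMap
  · rintro _ ⟨w, rfl⟩
    rw [mem_irrelevant_smul_top]
    intro j
    exact mem_irrelevant_smul_top.1 (h.minimal ⟨w, rfl⟩) j.succ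

end Resolution

/-! ### Perfection of the Bourbaki ideals -/

section Perfect

open CategoryTheory

universe u

/-- In a short exact sequence `0 → K → P → M → 0` with `P` projective, the projective dimension
bound of `M` is one more than that of `K`. -/
theorem hasProjectiveDimensionLT_iff_of_exact {A : Type u} [CommRing A] {K P M : Type u}
    [AddCommGroup K] [Module A K] [AddCommGroup P] [Module A P] [AddCommGroup M] [Module A M]
    [Module.Projective A P] {i : K →ₗ[A] P} {p : P →ₗ[A] M} (hi : Function.Injective i)
    (hp : Function.Surjective p) (hex : Function.Exact i p) (n : ℕ) :
    HasProjectiveDimensionLT (ModuleCat.of A M) (n + 2) ↔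
      HasProjectiveDimensionLT (ModuleCat.of A K) (n + 1) := by
  let S : ShortComplex (ModuleCat.{u} A) :=
    ShortComplex.mk (ModuleCat.ofHom i) (ModuleCat.ofHom p) (by
      ext x
      exact hex.apply_apply_eq_zero x)
  have hS : S.ShortExact := ModuleCat.shortComplex_shortExact S hex hi hp
  exact hS.hasProjectiveDimensionLT_X₃_iff n
    ((IsProjective.iff_projective P).1 inferInstance)

theorem hasProjectiveDimensionLT_one_iff {A : Type u} [CommRing A] {M : Type u}
    [AddCommGroup M] [Module A M] :
    HasProjectiveDimensionLT (ModuleCat.of A M) 1 ↔ Module.Projective A M := by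
  rw [← projective_iff_hasProjectiveDimensionLT_one, IsProjective.iff_projective]

/-- If an ideal `I` has a free resolution of length one but is not projective, then `A ⧸ I` has
projective dimension two. -/
theorem projectiveDimension_quotient_eq_two {A : Type u} [CommRing A] {I : Ideal A} {K P : Type u}
    [AddCommGroup K] [Module A K] [AddCommGroup P] [Module A P]
    [Module.Projective A K] [Module.Projective A P] {i : K →ₗ[A] P} {p : P →ₗ[A] I}
    (hi : Function.Injective i) (hp : Function.Surjective p) (hex : Function.Exact i p)
    (hI : ¬ Module.Projective A I) :
    projectiveDimension (ModuleCat.of A (A ⧸ I)) = (2 : ℕ) := by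
  have hq : ∀ n, HasProjectiveDimensionLT (ModuleCat.of A (A ⧸ I)) (n + 2) ↔
      HasProjectiveDimensionLT (ModuleCat.of A I) (n + 1) := fun n =>
    hasProjectiveDimensionLT_iff_of_exact (i := I.subtype) (p := I.mkQ) I.injective_subtype
      I.mkQ_surjective (LinearMap.exact_subtype_mkQ I) n
  refine le_antisymm ((projectiveDimension_le_iff _ _).2 ?_) ((projectiveDimension_ge_iff _ _).2 ?_)
  · exact (hq 1).2 ((hasProjectiveDimensionLT_iff_of_exact hi hp hex 0).2
      (hasProjectiveDimensionLT_one_iff.2 inferInstance))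
  · rw [hq 0, zero_add, hasProjectiveDimensionLT_one_iff]
    exact hI

variable {k : Type*} [Field k] {f : Ring3 k}

open scoped Pointwise in
theorem isWeaklyRegular_pair {A : Type*} [CommRing A] [IsDomain A] {a b : A} (ha : a ≠ 0)
    (hb : ∀ c, a ∣ b * c → a ∣ c) : RingTheory.Sequence.IsWeaklyRegular A [a, b] := by
  rw [RingTheory.Sequence.isWeaklyRegular_cons_iff,
    RingTheory.Sequence.isWeaklyRegular_singleton_iff]
  refine ⟨fun x y hxy => mul_left_cancel₀ ha hxy, ?_⟩
  rw [isSMulRegular_iff_right_eq_zero_of_smul]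
  intro x hx
  obtain ⟨c, rfl⟩ := Submodule.Quotient.mk_surjective _ x
  have hmem : ∀ y : A, y ∈ a • (⊤ : Submodule A A) ↔ a ∣ y := fun y => by
    rw [Submodule.mem_smul_pointwise_iff_exists]
    exact ⟨fun ⟨z, _, hz⟩ => ⟨z, hz.symm⟩, fun ⟨z, hz⟩ => ⟨z, trivial, hz.symm⟩⟩
  rw [← Submodule.Quotient.mk_smul, Submodule.Quotient.mk_eq_zero, hmem] at hx
  rw [Submodule.Quotient.mk_eq_zero, hmem]
  exact hb c hx

/-- An ideal of height two isomorphic to `M_ε` has grade two: a regular sequence of three elements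
in it would force it to be the unit ideal. -/
theorem grade_eq_two {ε : Syz f} (hε0 : ε ≠ 0) {I : Ideal (Ring3 k)} (hI : I ≠ ⊤)
    (hht : I.height = 2) (θ : SyzCoker f ε ≃ₗ[Ring3 k] I) : grade I = 2 := by
  refine le_antisymm (iSup_le fun rs => iSup_le fun hrs => iSup_le fun hmem => ?_) ?_
  · match rs, hrs, hmem with
    | [], _, _ => simp
    | [_], _, _ => norm_num
    | [_, _], _, _ => norm_num
    | r₁ :: r₂ :: r₃ :: l, hrs, hmem =>
      exfalso
      refine hI ((Ideal.eq_top_iff_one I).2 (mem_of_regularTriple_mul_mem hε0 θ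
        (isRegularTriple_of_isWeaklyRegular hrs.toIsWeaklyRegular) ?_ ?_ ?_)) <;>
      · rw [mul_one]
        exact hmem _ (by simp)
  · obtain ⟨a, haI, b, hbI, ha, hab⟩ := exists_coprime_pair_of_two_le_height hht.ge
    have hmem : ∀ r ∈ [a, b], r ∈ I := by simp [haI, hbI]
    have hreg : RingTheory.Sequence.IsRegular (Ring3 k) [a, b] := by
      refine ⟨isWeaklyRegular_pair ha hab, fun h => hI (top_unique ?_)⟩
      rw [h, smul_eq_mul, Ideal.mul_top]
      exact Ideal.span_le.2 hmem
    exact le_iSup_of_le [a, b] (le_iSup_of_le hreg (le_iSup_of_le hmem (by norm_num)))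

end Perfect

/-! ### Hilbert functions -/

section Hilbert

variable {k : Type*} [Field k]

theorem homogeneousSubmodule_eq_span (n : ℕ) :
    homogeneousSubmodule (Fin 3) k n = Submodule.span k
      (Set.range fun m : (Finset.univ : Finset (Fin 3)).finsuppAntidiag n =>
        (monomial (m : Fin 3 →₀ ℕ) (1 : k))) := by
  have hmem : ∀ m : Fin 3 →₀ ℕ, m ∈ (Finset.univ : Finset (Fin 3)).finsuppAntidiag n ↔
      m.degree = n := fun m => by
    rw [Finset.mem_finsuppAntidiag, Finsupp.degree_eq_sum]
    simp
  refine le_antisymm (fun p hp => ?_) (Submodule.span_le.2 ?_)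
  · rw [p.as_sum]
    refine Submodule.sum_mem _ fun m hm => ?_
    have hdeg : m.degree = n := by
      by_contra h
      exact mem_support_iff.1 hm (IsHomogeneous.coeff_eq_zero hp h)
    rw [← mul_one (coeff m p), ← smul_eq_mul, ← smul_monomial]
    exact Submodule.smul_mem _ _ (Submodule.subset_span ⟨⟨m, (hmem m).2 hdeg⟩, rfl⟩)
  · rintro _ ⟨m, rfl⟩
    exact isHomogeneous_monomial _ ((hmem _).1 m.2)

instance finite_homogeneousSubmodule (n : ℕ) :
    Module.Finite k (homogeneousSubmodule (Fin 3) k n) := by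
  rw [homogeneousSubmodule_eq_span]
  exact Module.Finite.span_of_finite k (Set.finite_range _)

theorem finrank_homogeneousSubmodule (n : ℕ) :
    Module.finrank k (homogeneousSubmodule (Fin 3) k n) = (n + 2).choose 2 := by
  rw [homogeneousSubmodule_eq_span, finrank_span_eq_card]
  · rw [Fintype.card_coe, Finset.card_finsuppAntidiag_nat_eq_choose, Finset.card_univ,
      Fintype.card_fin, show 3 + n - 1 = n + 2 by omega, ← Nat.choose_symm (by omega)]
    congr 1
    omega
  · have := (basisMonomials (Fin 3) k).linearIndependent
    rw [coe_basisMonomials] at this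
    exact this.comp _ Subtype.val_injective

theorem two_mul_finrank_homogeneousSubmodule (n : ℕ) :
    2 * (Module.finrank k (homogeneousSubmodule (Fin 3) k n) : ℤ) = (n + 1) * (n + 2) := by
  rw [finrank_homogeneousSubmodule, Nat.choose_two_right]
  have h : 2 ∣ (n + 2) * (n + 2 - 1) := (Nat.even_mul_pred_self _).two_dvd
  have := Nat.div_mul_cancel h
  rw [show n + 2 - 1 = n + 1 by omega] at this ⊢
  generalize (n + 2) * (n + 1) / 2 = q at this ⊢
  zify at this
  linarith

/-- The component of degree `n` of an ideal. -/
noncomputable def idealPart (I : Ideal (Ring3 k)) (n : ℕ) : Submodule k (Ring3 k) :=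
  I.restrictScalars k ⊓ homogeneousSubmodule (Fin 3) k n

instance finite_idealPart (I : Ideal (Ring3 k)) (n : ℕ) : Module.Finite k (idealPart I n) :=
  Submodule.finiteDimensional_inf_right _ _

theorem hilbertFunction_add_finrank_idealPart (I : Ideal (Ring3 k)) (n : ℕ) :
    hilbertFunction I n + Module.finrank k (idealPart I n) =
      Module.finrank k (homogeneousSubmodule (Fin 3) k n) := by
  have h := Submodule.finrank_quotient_add_finrank
    ((I.restrictScalars k).comap (homogeneousSubmodule (Fin 3) k n).subtype)
  rw [← h, hilbertFunction, idealPart, inf_comm, ← Submodule.map_comap_subtype,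
    (Submodule.equivMapOfInjective _ (Submodule.injective_subtype _) _).finrank_eq]

theorem hilbertFunction_eq_zero_iff {I : Ideal (Ring3 k)} {n : ℕ} :
    hilbertFunction I n = 0 ↔ ∀ p : Ring3 k, p.IsHomogeneous n → p ∈ I := by
  rw [hilbertFunction, Module.finrank_zero_iff, Submodule.Quotient.subsingleton_iff,
    Submodule.comap_subtype_eq_top]
  exact Iff.rfl

theorem IsHilbertPolynomial.C_of_eventually {I : Ideal (Ring3 k)} {c : ℕ}
    (h : ∀ᶠ n in Filter.atTop, hilbertFunction I n = c) :
    IsHilbertPolynomial I (Polynomial.C (c : ℚ)) :=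
  h.mono fun n hn => by rw [hn, Polynomial.eval_C]

/-- If the Hilbert function of `R ⧸ I` is eventually a nonzero constant, this constant is the
degree. -/
theorem hasDegree_of_eventually {I : Ideal (Ring3 k)} {c : ℕ} (hc : c ≠ 0)
    (h : ∀ᶠ n in Filter.atTop, hilbertFunction I n = c) : HasDegree I (c : ℚ) := by
  refine ⟨_, IsHilbertPolynomial.C_of_eventually h, Or.inl ⟨?_, ?_⟩⟩
  · rw [Ne, Polynomial.C_eq_zero]
    exact_mod_cast hc
  · rw [Polynomial.natDegree_C, Polynomial.leadingCoeff_C]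
    simp

end Hilbert

/-! ### The Hilbert functions of the gradient ideal and of a Bourbaki ideal -/

section Comparison

variable {k : Type*} [Field k] {f : Ring3 k}

/-- The map `(g₀, g₁, g₂) ↦ g₀ f_x + g₁ f_y + g₂ f_z` on triples of forms of degree `N`. -/
noncomputable def gradMap (f : Ring3 k) (N : ℕ) :
    (Fin 3 → homogeneousSubmodule (Fin 3) k N) →ₗ[k] Ring3 k :=
  ((Fintype.linearCombination (Ring3 k) (grad f)).restrictScalars k) ∘ₗ
    LinearMap.pi fun i => (homogeneousSubmodule (Fin 3) k N).subtype ∘ₗ LinearMap.proj i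

theorem gradMap_apply (N : ℕ) (g : Fin 3 → homogeneousSubmodule (Fin 3) k N) :
    gradMap f N g = ∑ i, (g i : Ring3 k) * grad f i := rfl

theorem mem_Syz_of_mem_ker (N : ℕ) (g : LinearMap.ker (gradMap f N)) :
    (fun i => (g.1 i : Ring3 k)) ∈ Syz f :=
  mem_Syz.2 g.2

theorem range_gradMap {d N : ℕ} (hgrad : ∀ i, grad f i ∈ ringGrading k (d : ℤ)) :
    LinearMap.range (gradMap f N) = idealPart (gradientIdeal f) (N + d) := by
  ext p
  constructor
  · rintro ⟨g, rfl⟩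
    rw [gradMap_apply]
    exact ⟨Submodule.sum_mem _ fun i _ => Ideal.mul_mem_left _ _ (Ideal.subset_span ⟨i, rfl⟩),
      Submodule.sum_mem _ fun i _ => (g i).2.mul (mem_ringGrading_natCast.1 (hgrad i))⟩
  · rintro ⟨hpJ, hp⟩
    obtain ⟨c, hc⟩ := Ideal.mem_span_range_iff_exists_fun.1 hpJ
    refine ⟨fun i => ⟨comp (N : ℤ) (c i), mem_ringGrading_natCast.1 (comp_mem _ _)⟩, ?_⟩
    have h1 : comp ((N + d : ℕ) : ℤ) p = p :=
      comp_eq_self_iff.2 (mem_ringGrading_natCast.2 hp)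
    rw [gradMap_apply, ← h1, ← hc, map_sum]
    refine Finset.sum_congr rfl fun i _ => ?_
    change comp (N : ℤ) (c i) * grad f i = comp _ (c i * grad f i)
    rw [comp_mul _ (hgrad i)]
    push_cast
    rw [add_sub_cancel_right]

variable {ε : Syz f}

/-- The map from the syzygies of degree `N` to an ideal isomorphic to `M_ε`. -/
noncomputable def syzToIdeal {I : Ideal (Ring3 k)} (θ : SyzCoker f ε ≃ₗ[Ring3 k] I) (N : ℕ) :
    LinearMap.ker (gradMap f N) →ₗ[k] Ring3 k where
  toFun g := θ (Submodule.Quotient.mk ⟨_, mem_Syz_of_mem_ker N g⟩)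
  map_add' g g' := by
    rw [← Submodule.coe_add, ← map_add]
    rfl
  map_smul' c g := by
    have h1 : (⟨_, mem_Syz_of_mem_ker N (c • g)⟩ : Syz f) =
        (C c : Ring3 k) • ⟨_, mem_Syz_of_mem_ker N g⟩ :=
      Subtype.ext (funext fun i => smul_eq_C_mul _ _)
    rw [h1, Submodule.Quotient.mk_smul, map_smul, RingHom.id_apply, smul_eq_C_mul]
    rfl

theorem finrank_ker_syzToIdeal {I : Ideal (Ring3 k)} (θ : SyzCoker f ε ≃ₗ[Ring3 k] I)
    (hε0 : ε ≠ 0) {e s : ℕ} (hε : ε ∈ syzGrading f (e : ℤ)) :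
    Module.finrank k (LinearMap.ker (syzToIdeal θ (s + e))) =
      Module.finrank k (homogeneousSubmodule (Fin 3) k s) := by
  have hε' := mem_syzGrading_iff.1 hε
  have hεne : (ε : Fin 3 → Ring3 k) ≠ 0 := fun h => hε0 (Subtype.ext h)
  -- The kernel consists of the multiples `c ε` with `c` a form of degree `s`.
  let μ : homogeneousSubmodule (Fin 3) k s →ₗ[k] LinearMap.ker (gradMap f (s + e)) :=
    { toFun := fun c => ⟨fun i => ⟨c.1 * ε.1 i, c.2.mul (mem_ringGrading_natCast.1 (hε' i))⟩, by
        rw [LinearMap.mem_ker, gradMap_apply]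
        simp only [mul_assoc, ← Finset.mul_sum, mem_Syz.1 ε.2, mul_zero]⟩
      map_add' := fun c c' => Subtype.ext (funext fun i => Subtype.ext (add_mul _ _ _))
      map_smul' := fun r c => Subtype.ext (funext fun i => Subtype.ext (smul_mul_assoc _ _ _)) }
  have hμ : Function.Injective μ := by
    intro c c' hcc
    obtain ⟨i, hi⟩ := Function.ne_iff.1 hεne
    refine Subtype.ext (mul_right_cancel₀ hi ?_)
    exact congrArg (fun g => ((g.1 i : homogeneousSubmodule (Fin 3) k (s + e)) : Ring3 k)) hcc
  have hrange : LinearMap.range μ = LinearMap.ker (syzToIdeal θ (s + e)) := by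
    ext g
    have hker : g ∈ LinearMap.ker (syzToIdeal θ (s + e)) ↔
        ∃ c : Ring3 k, c • ε = (⟨_, mem_Syz_of_mem_ker (s + e) g⟩ : Syz f) := by
      rw [← Submodule.mem_span_singleton, ← Submodule.Quotient.mk_eq_zero,
        ← LinearEquiv.map_eq_zero_iff θ, LinearMap.mem_ker]
      exact Submodule.coe_eq_zero
    rw [hker]
    constructor
    · rintro ⟨c, rfl⟩
      exact ⟨c.1, rfl⟩
    · rintro ⟨c, hc⟩
      have hci : ∀ i, c * ε.1 i = g.1 i := fun i => congrArg (fun v : Syz f => v.1 i) hc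
      have hcs : c.IsHomogeneous s := by
        obtain ⟨i, hi⟩ := Function.ne_iff.1 hεne
        have h1 : c * ε.1 i ∈ ringGrading k ((s + e : ℕ) : ℤ) := by
          rw [hci i]
          exact mem_ringGrading_natCast.2 (g.1 i).2
        have h2 := mem_ringGrading_of_mul_mem (hε' i) hi h1
        push_cast at h2
        rw [add_sub_cancel_right] at h2
        exact mem_ringGrading_natCast.1 h2
      exact ⟨⟨c, hcs⟩, Subtype.ext (funext fun i => Subtype.ext (hci i))⟩
  rw [← hrange, LinearMap.finrank_range_of_inj hμ]

theorem range_syzToIdeal {I : Ideal (Ring3 k)} (θ : SyzCoker f ε ≃ₗ[Ring3 k] I) {d e : ℤ}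
    (hθ : IsGradedIso (quotGrading (syzGrading f) (Submodule.span (Ring3 k) {ε}))
      (shift (subGrading (ringGrading k) I) (e - d)) θ) {N t : ℕ} (ht : (t : ℤ) = N + e - d) :
    LinearMap.range (syzToIdeal θ N) = idealPart I t := by
  have hiff : ∀ x, x ∈ quotGrading (syzGrading f) (Submodule.span (Ring3 k) {ε}) (N : ℤ) ↔
      ((θ x : I) : Ring3 k).IsHomogeneous t := fun x => by
    rw [hθ (N : ℤ) x, ← mem_ringGrading_natCast, ht, add_sub_assoc]
    exact Iff.rfl
  ext p
  constructor
  · rintro ⟨g, rfl⟩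
    refine ⟨(θ _).2, (hiff _).1 ⟨_, ?_, rfl⟩⟩
    exact mem_syzGrading_iff.2 fun i => mem_ringGrading_natCast.2 (g.1 i).2
  · rintro ⟨hpI, hp⟩
    obtain ⟨g, hg, hgx⟩ := (hiff (θ.symm ⟨p, hpI⟩)).2 (by
      rw [LinearEquiv.apply_symm_apply]; exact hp)
    have hg' := mem_syzGrading_iff.1 hg
    refine ⟨⟨fun i => ⟨g.1 i, mem_ringGrading_natCast.1 (hg' i)⟩, mem_Syz.1 g.2⟩, ?_⟩
    change ((θ (Submodule.Quotient.mk g) : I) : Ring3 k) = p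
    have h1 : Submodule.Quotient.mk g = θ.symm ⟨p, hpI⟩ := hgx
    rw [h1, LinearEquiv.apply_symm_apply]

/-- The Hilbert functions of `R ⧸ I`, for an ideal `I` with `M_ε ≃ I(e - d)`, and of `R ⧸ J_f` have
constant sum in complementary degrees. -/
theorem hilbertFunction_add_hilbertFunction {I : Ideal (Ring3 k)}
    (θ : SyzCoker f ε ≃ₗ[Ring3 k] I) {d e : ℕ} (hε0 : ε ≠ 0) (hε : ε ∈ syzGrading f (e : ℤ))
    (hgrad : ∀ i, grad f i ∈ ringGrading k (d : ℤ))
    (hθ : IsGradedIso (quotGrading (syzGrading f) (Submodule.span (Ring3 k) {ε}))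
      (shift (subGrading (ringGrading k) I) ((e : ℤ) - d)) θ) {s t : ℕ}
    (ht : t + d = s + 2 * e) :
    (hilbertFunction I t : ℤ) + hilbertFunction (gradientIdeal f) (s + e + d) =
      (d : ℤ) ^ 2 + e * (e - d) := by
  have h1 := LinearMap.finrank_range_add_finrank_ker (gradMap f (s + e))
  rw [range_gradMap hgrad, Module.finrank_pi_fintype] at h1
  have h2 := LinearMap.finrank_range_add_finrank_ker (V := LinearMap.ker (gradMap f (s + e)))
    (syzToIdeal θ (s + e))
  rw [range_syzToIdeal θ hθ (t := t) (by push_cast; omega), finrank_ker_syzToIdeal θ hε0 hε] at h2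
  have h3 := hilbertFunction_add_finrank_idealPart I t
  have h4 := hilbertFunction_add_finrank_idealPart (gradientIdeal f) (s + e + d)
  have d1 := two_mul_finrank_homogeneousSubmodule (k := k) t
  have d2 := two_mul_finrank_homogeneousSubmodule (k := k) (s + e + d)
  have d3 := two_mul_finrank_homogeneousSubmodule (k := k) (s + e)
  have d4 := two_mul_finrank_homogeneousSubmodule (k := k) s
  rw [Finset.sum_const, Finset.card_univ, Fintype.card_fin, smul_eq_mul] at h1
  have ht' : (t : ℤ) = s + 2 * e - d := by omega
  rw [ht'] at d1
  zify at h1 h2 h3 h4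
  push_cast at d1 d2 d3 d4
  -- With `H(n) = (n + 1)(n + 2) / 2`, the combination `H(t) + H(s + e + d) - 3 H(s + e) + H(s)` does
  -- not depend on `s`.
  have key : 2 * ((hilbertFunction I t : ℤ) + hilbertFunction (gradientIdeal f) (s + e + d)) =
      2 * ((d : ℤ) ^ 2 + e * (e - d)) := by
    linear_combination 2 * h3 + 2 * h4 - 2 * h1 - 2 * h2 + d1 + d2 - 3 * d3 + d4
  linarith

/-- The Hilbert function of `R ⧸ I` does not decrease: some linear form is a nonzerodivisor. -/
theorem monotone_hilbertFunction [IsAlgClosed k] (hε0 : ε ≠ 0) {I : Ideal (Ring3 k)}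
    (θ : SyzCoker f ε ≃ₗ[Ring3 k] I) : Monotone (hilbertFunction I) := by
  classical
  -- A linear form outside the finitely many associated primes exists because `k` is infinite and no
  -- associated prime contains all linear forms.
  let ℓ : (Fin 3 → k) →ₗ[k] Ring3 k := Fintype.linearCombination k X
  have hfin := associatedPrimes.finite (Ring3 k) (Ring3 k ⧸ I)
  let W : Finset (Subspace k (Fin 3 → k)) :=
    hfin.toFinset.image fun P => (P.restrictScalars k).comap ℓ
  have hW : ⊤ ∉ W := by
    intro htop
    obtain ⟨P, hP, hPtop⟩ := Finset.mem_image.1 htop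
    obtain ⟨i, hi⟩ := exists_X_notMem_of_mem_associatedPrimes hε0 θ (hfin.mem_toFinset.1 hP)
    have hmem : Pi.single i 1 ∈ (P.restrictScalars k).comap ℓ := by
      rw [hPtop]; exact Submodule.mem_top
    refine hi ?_
    have : ℓ (Pi.single i 1) ∈ P := hmem
    rwa [Fintype.linearCombination_apply_single, one_smul] at this
  obtain ⟨v, hv⟩ := (Set.ne_univ_iff_exists_notMem _).1 (Subspace.biUnion_ne_univ_of_top_notMem hW)
  have hvP : ∀ P ∈ associatedPrimes (Ring3 k) (Ring3 k ⧸ I), ℓ v ∉ P := fun P hP hmem =>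
    hv (Set.mem_biUnion (Finset.mem_coe.2
      (Finset.mem_image_of_mem _ (hfin.mem_toFinset.2 hP))) hmem)
  have hreg : ∀ c, ℓ v * c ∈ I → c ∈ I := by
    intro c hc
    by_contra hcI
    have hzd : ℓ v ∈ {r : Ring3 k | ∃ x : Ring3 k ⧸ I, x ≠ 0 ∧ r • x = 0} :=
      ⟨Ideal.Quotient.mk I c, mt Ideal.Quotient.eq_zero_iff_mem.1 hcI,
        Ideal.Quotient.eq_zero_iff_mem.2 hc⟩
    rw [← biUnion_associatedPrimes_eq_zero_divisors] at hzd
    obtain ⟨P, hP, hmem⟩ := Set.mem_iUnion₂.1 hzd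
    exact hvP P hP hmem
  have hhom : (ℓ v).IsHomogeneous 1 := by
    rw [Fintype.linearCombination_apply]
    exact Submodule.sum_mem (homogeneousSubmodule (Fin 3) k 1) fun i _ =>
      Submodule.smul_mem _ _ (isHomogeneous_X k i)
  refine monotone_nat_of_le_succ fun n => ?_
  let μ : homogeneousSubmodule (Fin 3) k n →ₗ[k] homogeneousSubmodule (Fin 3) k (n + 1) :=
    { toFun := fun p => ⟨p.1 * ℓ v, p.2.mul hhom⟩
      map_add' := fun p q => Subtype.ext (add_mul _ _ _)
      map_smul' := fun c p => Subtype.ext (smul_mul_assoc _ _ _) }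
  have hμ : (I.restrictScalars k).comap (homogeneousSubmodule (Fin 3) k n).subtype =
      ((I.restrictScalars k).comap (homogeneousSubmodule (Fin 3) k (n + 1)).subtype).comap μ := by
    ext p
    exact ⟨fun hp => Ideal.mul_mem_right (ℓ v) I hp, fun hp => hreg p.1 (by
      rw [mul_comm]; exact hp)⟩
  refine LinearMap.finrank_le_finrank_of_injective (f := Submodule.mapQ _ _ μ hμ.le) ?_
  rw [← LinearMap.ker_eq_bot, Submodule.ker_mapQ, ← hμ, Submodule.mkQ_map_self]

/-- Both Hilbert functions are eventually constant. -/
theorem exists_eventually_hilbertFunction_eq [IsAlgClosed k] {I : Ideal (Ring3 k)}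
    (θ : SyzCoker f ε ≃ₗ[Ring3 k] I) {d e : ℕ} (hε0 : ε ≠ 0) (hε : ε ∈ syzGrading f (e : ℤ))
    (hgrad : ∀ i, grad f i ∈ ringGrading k (d : ℤ))
    (hθ : IsGradedIso (quotGrading (syzGrading f) (Submodule.span (Ring3 k) {ε}))
      (shift (subGrading (ringGrading k) I) ((e : ℤ) - d)) θ) :
    ∃ c τ : ℕ, (∀ᶠ n in Filter.atTop, hilbertFunction I n = c) ∧
      (∀ᶠ n in Filter.atTop, hilbertFunction (gradientIdeal f) n = τ) ∧
      (c : ℤ) + τ = (d : ℤ) ^ 2 + e * (e - d) := by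
  have hsum : ∀ s t : ℕ, t + d = s + 2 * e →
      (hilbertFunction I t : ℤ) + hilbertFunction (gradientIdeal f) (s + e + d) =
        (d : ℤ) ^ 2 + e * (e - d) := fun s t ht =>
    hilbertFunction_add_hilbertFunction θ hε0 hε hgrad hθ ht
  have hmono := monotone_hilbertFunction hε0 θ
  have hbdd : ∀ t, hilbertFunction I t ≤ ((d : ℤ) ^ 2 + e * (e - d)).toNat := by
    intro t
    have h1 := hmono (show t ≤ t + 2 * e by omega)
    have h2 := hsum (t + d) (t + 2 * e) (by omega)
    omega
  obtain ⟨c, hc⟩ : ∃ c, ∀ᶠ n in Filter.atTop, hilbertFunction I n = c := by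
    obtain ⟨_, ⟨n₀, rfl⟩, hmax⟩ := BddAbove.exists_isGreatest_of_nonempty
      (S := Set.range (hilbertFunction I)) ⟨_, by rintro _ ⟨t, rfl⟩; exact hbdd t⟩
      (Set.range_nonempty _)
    exact ⟨hilbertFunction I n₀, Filter.eventually_atTop.2
      ⟨n₀, fun n hn => le_antisymm (hmax ⟨n, rfl⟩) (hmono hn)⟩⟩
  obtain ⟨n₀, hn₀⟩ := Filter.eventually_atTop.1 hc
  have hJ : ∀ n, n₀ + 3 * e + 3 * d ≤ n → (c : ℤ) + hilbertFunction (gradientIdeal f) n =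
      (d : ℤ) ^ 2 + e * (e - d) := by
    intro n hn
    have h1 := hsum (n - e - d) (n + e - 2 * d) (by omega)
    rw [hn₀ _ (by omega), show n - e - d + e + d = n by omega] at h1
    exact h1
  refine ⟨c, hilbertFunction (gradientIdeal f) (n₀ + 3 * e + 3 * d), hc,
    Filter.eventually_atTop.2 ⟨n₀ + 3 * e + 3 * d, fun n hn => ?_⟩, hJ _ le_rfl⟩
  have h1 := hJ n hn
  have h2 := hJ _ le_rfl
  omega

end Comparison

/-! ### Singular and smooth curves -/

section Curves

variable {k : Type*} [Field k] {f : Ring3 k}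

theorem hilbertFunction_ne_zero_of_zero {I : Ideal (Ring3 k)} {p : Fin 3 → k} (hp : p ≠ 0)
    (hI : ∀ q ∈ I, eval p q = 0) (n : ℕ) : hilbertFunction I n ≠ 0 := by
  rw [Ne, hilbertFunction_eq_zero_iff]
  intro h
  obtain ⟨i, hi⟩ := Function.ne_iff.1 hp
  have := hI _ (h _ (isHomogeneous_X_pow i n))
  rw [map_pow, eval_X] at this
  exact hi (eq_zero_of_pow_eq_zero this)

theorem eval_eq_zero_of_mem_gradientIdeal {p : Fin 3 → k}
    (hp : ∀ i, eval p (pderiv i f) = 0) {q : Ring3 k} (hq : q ∈ gradientIdeal f) :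
    eval p q = 0 := by
  have : gradientIdeal f ≤ RingHom.ker (eval p) := Ideal.span_le.2 (by
    rintro _ ⟨i, rfl⟩
    exact hp i)
  exact this hq

theorem mem_irrelevant_pow_of_isHomogeneous {n : ℕ} {p : Ring3 k} (hp : p.IsHomogeneous n) :
    p ∈ irrelevant k ^ n := by
  rw [p.as_sum]
  refine Submodule.sum_mem _ fun m hm => ?_
  have hdeg : m.degree = n := by
    by_contra h
    exact mem_support_iff.1 hm (hp.coeff_eq_zero h)
  rw [monomial_eq, ← hdeg, Finsupp.degree_eq_sum, ← Finset.prod_pow_eq_pow_sum,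
    Finsupp.prod_fintype _ _ fun i => pow_zero _]
  refine Ideal.mul_mem_left _ _ (Ideal.prod_mem_prod fun i _ => ?_)
  have hX : (X i : Ring3 k) ∈ irrelevant k := Ideal.subset_span ⟨i, rfl⟩
  exact Ideal.pow_mem_pow hX _

/-- For a smooth curve the gradient ideal is primary to the irrelevant ideal, by the
Nullstellensatz. -/
theorem eventually_hilbertFunction_gradientIdeal_eq_zero [IsAlgClosed k] {n : ℕ}
    (hn : (n : k) ≠ 0) (hf : f.IsHomogeneous n) (hs : IsSmoothCurve f) :
    ∀ᶠ n in Filter.atTop, hilbertFunction (gradientIdeal f) n = 0 := by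
  have hrad : irrelevant k ≤ (gradientIdeal f).radical := by
    rw [← vanishingIdeal_zeroLocus_eq_radical (K := k), irrelevant, Ideal.span_le]
    rintro _ ⟨i, rfl⟩
    rw [SetLike.mem_coe, mem_vanishingIdeal_iff]
    intro p hp
    rw [aeval_X]
    by_contra hpi
    have hpd : ∀ j, eval p (pderiv j f) = 0 := fun j => by
      have := hp (pderiv j f) (Ideal.subset_span ⟨j, rfl⟩)
      rwa [aeval_eq_eval] at this
    refine hs (show IsSingularCurve f from ⟨p, fun h => hpi (by rw [h]; rfl), ?_, hpd⟩)
    have h1 := congrArg (eval p) (sum_X_mul_grad hf)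
    rw [map_sum, map_mul, map_natCast] at h1
    rw [Finset.sum_eq_zero fun j _ => by rw [map_mul, grad, hpd j, mul_zero]] at h1
    exact (mul_eq_zero.1 h1.symm).resolve_left hn
  obtain ⟨N, hN⟩ := Ideal.exists_pow_le_of_le_radical_of_fg hrad (IsNoetherian.noetherian _)
  refine Filter.eventually_atTop.2 ⟨N, fun n hn => hilbertFunction_eq_zero_iff.2 fun p hp => ?_⟩
  exact hN (Ideal.pow_le_pow_right hn (mem_irrelevant_pow_of_isHomogeneous hp))

/-- The Hilbert function of `R ⧸ I` does not vanish if `I` is a proper ideal isomorphic to `M_ε`. -/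
theorem hilbertFunction_ne_zero {ε : Syz f} (hε0 : ε ≠ 0) {I : Ideal (Ring3 k)} (hI : I ≠ ⊤)
    (θ : SyzCoker f ε ≃ₗ[Ring3 k] I) (n : ℕ) : hilbertFunction I n ≠ 0 := by
  rw [Ne, hilbertFunction_eq_zero_iff]
  intro h
  obtain ⟨P, hP, hIP⟩ := exists_mem_associatedPrimes hI
  obtain ⟨i, hi⟩ := exists_X_notMem_of_mem_associatedPrimes hε0 θ hP
  exact hi (hP.isPrime.mem_of_pow_mem n (hIP (h _ (isHomogeneous_X_pow i n))))

end Curves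

/-! ### The dichotomy between free divisors and proper Bourbaki ideals -/

section Dichotomy

/-- An ideal which is free as a module is generated by a single element; if it contains the entries
of a vector without common prime factor, this element is a unit. -/
theorem eq_top_of_free {A : Type*} [CommRing A] [IsDomain A] [UniqueFactorizationMonoid A]
    {ι : Type*} {v : ι → A} (hv0 : v ≠ 0) (hv : ∀ p, Prime p → ∃ i, ¬ p ∣ v i) {I : Ideal A}
    (hI : ∀ i, v i ∈ I) (hfree : Module.Free A I) : I = ⊤ := by
  let b := Module.Free.chooseBasis A I
  obtain ⟨j, hj⟩ := Function.ne_iff.1 hv0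
  have hne : Nonempty (Module.Free.ChooseBasisIndex A I) := by
    by_contra h
    rw [not_nonempty_iff] at h
    have : Subsingleton I := b.repr.toEquiv.subsingleton
    exact hj (congrArg Subtype.val (Subsingleton.elim (⟨v j, hI j⟩ : I) 0))
  obtain ⟨i⟩ := hne
  have hdvd : ∀ x : I, (b i : A) ∣ x := fun x => by
    have h1 : (x : A) • b i = (b i : A) • x := Subtype.ext (mul_comm _ _)
    have h2 := congrArg (fun y => b.repr y i) h1
    simp only [map_smul, Finsupp.smul_apply, b.repr_self, Finsupp.single_eq_same, smul_eq_mul,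
      mul_one] at h2
    exact ⟨_, h2⟩
  refine Ideal.eq_top_of_isUnit_mem I (b i).2 ?_
  by_contra hu
  have hb0 : (b i : A) ≠ 0 := fun h => b.ne_zero i (Subtype.ext h)
  obtain ⟨p, hp, hpb⟩ := WfDvdMonoid.exists_irreducible_factor hu hb0
  obtain ⟨l, hl⟩ := hv p hp.prime
  exact hl (hpb.trans (hdvd ⟨v l, hI l⟩))

end Dichotomy

end PlaneCurve

theorem mainTheorem1 {k : Type*} [Field k] [IsAlgClosed k]
    (d : ℕ) (hd : 1 ≤ d) (hchar : ((d + 1 : ℕ) : k) ≠ 0)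
    (f : Ring3 k) (hf0 : f ≠ 0) (hf : f.IsHomogeneous (d + 1))
    (hred : (Ideal.span {f}).IsRadical)
    (e : ℕ) (he : 1 ≤ e) (ε : Syz f) (hε : IsMinimalHomogeneousGenerator f ε e) :
    -- (a)
    ((Module.Free (Ring3 k) (SyzCoker f ε) ↔ IsFreeDivisor f) ∧
      (IsFreeDivisor f →
        HasDegree (gradientIdeal f) ((d : ℚ) ^ 2 + (e : ℚ) * ((e : ℚ) - (d : ℚ))))) ∧
    -- (b)
    (¬ IsFreeDivisor f →
      (∃ (I : Ideal (Ring3 k)) (θ : SyzCoker f ε ≃ₗ[Ring3 k] I),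
        IsBourbakiIdeal f ε ((e : ℤ) - (d : ℤ)) I θ) ∧
      ∀ (I : Ideal (Ring3 k)) (θ : SyzCoker f ε ≃ₗ[Ring3 k] I),
        IsBourbakiIdeal f ε ((e : ℤ) - (d : ℤ)) I θ →
        (IsSingularCurve f → ∃ τ : ℚ, HasDegree (gradientIdeal f) τ ∧
          HasDegree I ((d : ℚ) ^ 2 + (e : ℚ) * ((e : ℚ) - (d : ℚ)) - τ)) ∧
        (IsSmoothCurve f →
          HasDegree I ((d : ℚ) ^ 2 + (e : ℚ) * ((e : ℚ) - (d : ℚ))))) ∧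
    -- (c)
    (¬ IsFreeDivisor f →
      (∀ (m : ℕ) (σ : Fin (m + 1) → Syz f) (a : Fin (m + 1) → ℤ),
        IsMinimalHomogeneousGenerators f σ a → σ 0 = ε →
        (∃ (n : ℕ) (b : Fin n → ℤ)
          (Ψ : (Fin n → Ring3 k) →ₗ[Ring3 k] (Fin (m + 1) → Ring3 k)),
          IsMinimalGradedFreeResolution (syzGrading f) a b Ψ
            (Fintype.linearCombination (Ring3 k) σ)) ∧
        ∀ (n : ℕ) (b : Fin n → ℤ)
          (Ψ : (Fin n → Ring3 k) →ₗ[Ring3 k] (Fin (m + 1) → Ring3 k)),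
          IsMinimalGradedFreeResolution (syzGrading f) a b Ψ
            (Fintype.linearCombination (Ring3 k) σ) →
          ∀ (I : Ideal (Ring3 k)) (θ : SyzCoker f ε ≃ₗ[Ring3 k] I),
            IsBourbakiIdeal f ε ((e : ℤ) - (d : ℤ)) I θ →
            IsMinimalGradedFreeResolution (subGrading (ringGrading k) I)
              (fun i : Fin m => a i.succ - ((d : ℤ) - (e : ℤ)))
              (fun j : Fin n => b j - ((d : ℤ) - (e : ℤ)))
              (LinearMap.funLeft (Ring3 k) (Ring3 k) Fin.succ ∘ₗ Ψ)
              (θ.toLinearMap ∘ₗ (Submodule.span (Ring3 k) {ε}).mkQ ∘ₗ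
                Fintype.linearCombination (Ring3 k) fun i : Fin m => σ i.succ)) ∧
      ∀ (I : Ideal (Ring3 k)) (θ : SyzCoker f ε ≃ₗ[Ring3 k] I),
        IsBourbakiIdeal f ε ((e : ℤ) - (d : ℤ)) I θ → I.height = 2 ∧ IsPerfect I) := by
  have hgrad := grad_mem_ringGrading hf
  have h0 := grad_ne_zero hchar hf0 hf
  have hgcd := exists_not_dvd_grad hchar hf0 hf hred
  obtain ⟨m₀, σ₀, a₀, hσ₀, hσε, ha₀⟩ := hε.exists_zero
  have hε0 : ε ≠ 0 := hσε ▸ hσ₀.ne_zero 0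
  have hεe : ε ∈ syzGrading f (e : ℤ) := by
    rw [← hσε, ← ha₀]
    exact hσ₀.homogeneous 0
  have hεv0 : (ε : Fin 3 → Ring3 k) ≠ 0 := fun h => hε0 (Subtype.ext h)
  have hεgcd : ∀ p, Prime p → ∃ i, ¬ p ∣ (ε : Fin 3 → Ring3 k) i := hσε ▸ hσ₀.exists_not_dvd 0
  have hfree : Module.Free (Ring3 k) (SyzCoker f ε) ↔ IsFreeDivisor f :=
    hσε ▸ hσ₀.free_SyzCoker_iff hchar hf0 hf
  have hproj : ¬ IsFreeDivisor f → ¬ Module.Projective (Ring3 k) (SyzCoker f ε) := fun hnf hp => by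
    subst hσε
    exact hnf (hfree.1 (hσ₀.free_of_projective_SyzCoker hp))
  obtain ⟨h, hh⟩ := exists_bourbakiMap h0 hgcd ε
  have hker := ker_bourbakiMap h0 hε0 hεgcd hh
  have hθ₀ := isGradedIso_bourbakiEquiv h0 hgrad hεe hh hker
  have hent := entry_mem_range_bourbakiMap h0 hh
  have hpos : (0 : ℤ) < (d : ℤ) ^ 2 + e * (e - d) := by
    have : (1 : ℤ) ≤ d := by exact_mod_cast hd
    -- `4 (d² + e (e - d)) = 3 d² + (d - 2 e)²`
    nlinarith [sq_nonneg ((d : ℤ) - 2 * e)]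
  refine ⟨⟨hfree, fun hF => ?_⟩, fun hnF => ⟨?_, fun I θ hIθ => ?_⟩,
    fun hnF => ⟨fun m σ a hσ hσ0 => ⟨hσ.exists_resolution, fun n b Ψ hΨ I θ hIθ => ?_⟩,
      fun I θ hIθ => ⟨hIθ.height_eq, ?_⟩⟩⟩
  · -- For a free divisor the Bourbaki ideal is the unit ideal and has zero Hilbert function.
    have hM := hfree.2 hF
    have htop : (LinearMap.range h : Ideal (Ring3 k)) = ⊤ :=
      eq_top_of_free hεv0 hεgcd hent (Module.Free.of_equiv (bourbakiEquiv h hker))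
    obtain ⟨c, τ, hc, hτ, hsum⟩ := exists_eventually_hilbertFunction_eq (bourbakiEquiv h hker)
      hε0 hεe hgrad hθ₀
    obtain ⟨n, hn⟩ := hc.exists
    have hc0 : c = 0 := by
      rw [← hn, hilbertFunction_eq_zero_iff]
      intro p _
      rw [htop]
      trivial
    have hτ' : (τ : ℤ) = (d : ℤ) ^ 2 + e * (e - d) := by rw [← hsum, hc0]; simp
    have hτq : (d : ℚ) ^ 2 + (e : ℚ) * ((e : ℚ) - (d : ℚ)) = (τ : ℚ) := by exact_mod_cast hτ'.symm
    rw [hτq]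
    exact hasDegree_of_eventually (by omega) hτ
  · -- Otherwise the image of `h` is a proper ideal, which is the Bourbaki ideal.
    have hne : (LinearMap.range h : Ideal (Ring3 k)) ≠ ⊤ := fun htop => hnF (hfree.1
      (Module.Free.of_equiv ((bourbakiEquiv h hker).trans
        ((LinearEquiv.ofEq _ _ htop).trans Submodule.topEquiv)).symm))
    have hhom := isHomogeneous_range_bourbakiMap h0 hgrad hεe hh
    exact ⟨LinearMap.range h, bourbakiEquiv h hker, hne, hhom,
      le_antisymm (height_le_two hε0 hne hhom (bourbakiEquiv h hker))
        (two_le_height_of_mem hεv0 hεgcd hent), hθ₀⟩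
  · obtain ⟨c, τ, hc, hτ, hsum⟩ := exists_eventually_hilbertFunction_eq θ hε0 hεe hgrad hIθ.graded
    obtain ⟨n, hn⟩ := hc.exists
    have hc0 : c ≠ 0 := hn ▸ hilbertFunction_ne_zero hε0 hIθ.ne_top θ n
    have hcq : (d : ℚ) ^ 2 + (e : ℚ) * ((e : ℚ) - (d : ℚ)) = (c : ℚ) + τ := by
      exact_mod_cast hsum.symm
    refine ⟨fun hs => ⟨τ, ?_, ?_⟩, fun hs => ?_⟩
    · obtain ⟨p, hp, -, hpd⟩ := hs
      obtain ⟨l, hl⟩ := hτ.exists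
      exact hasDegree_of_eventually (hl ▸ hilbertFunction_ne_zero_of_zero hp
        (fun q hq => eval_eq_zero_of_mem_gradientIdeal hpd hq) l) hτ
    · rw [hcq, add_sub_cancel_right]
      exact hasDegree_of_eventually hc0 hc
    · obtain ⟨l, hl, hl'⟩ :=
        (hτ.and (eventually_hilbertFunction_gradientIdeal_eq_zero hchar hf hs)).exists
      rw [hcq, ← hl, hl', Nat.cast_zero, add_zero]
      exact hasDegree_of_eventually hc0 hc
  · subst hσ0
    exact hΨ.tail hσ θ (by rw [neg_sub]; exact hIθ.graded)
  · obtain ⟨n, b, Ψ, hΨ⟩ := hσ₀.exists_resolution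
    subst hσε
    have hres := hΨ.tail hσ₀ θ (s := (d : ℤ) - e) (by rw [neg_sub]; exact hIθ.graded)
    have hIp : ¬ Module.Projective (Ring3 k) I := fun hp =>
      hproj hnF (Module.Projective.of_equiv θ.symm)
    rw [IsPerfect, grade_eq_two hε0 hIθ.ne_top hIθ.height_eq θ]
    exact projectiveDimension_quotient_eq_two hres.injective hres.surjective hres.exact hIp
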